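/- **Setting.** Let $d,m\ge 1$ be integers. For probability distributions $P_1,\dots,P_m$ (sources) and $Q$ (target) of a pair $(X,Y)\in\mathbb R^d\times\{0,1\}$ write $P_{i,X},Q_X$ for the marginal laws of $X$ and $\eta_{P_i}(x)=P_i(Y=1\mid X=x)$, $\eta_Q(x)=Q(Y=1\mid X=x)$ for the regression functions. For a classifier $f:\mathbb R^d\to\{0,1\}$ let $\mathcal E_Q(f)=Q(f(X)\ne Y)-Q(f_Q^*(X)\ne Y)$ be its excess risk, where $f_Q^*=\mathbf 1\{\eta_Q>1/2\}$ is the Bayes classifier. **The class $\Pi(\alpha,\beta,\gamma,\mu)$.** Fix $\alpha\ge 0$, $\beta>0$, $\gamma=(\gamma_1,\dots,\gamma_m)$ with all $\gamma_i>0$, $\mu=(\mu_-,\mu_+)$ with $0<\mu_-<\mu_+$, and constants $C_\alpha,C_\beta,C_{\gamma_1},\dots,C_{\gamma_m},c_\mu,r_\mu>0$. The class consists of all $(P_1,\dots,P_m,Q)$ such that, for suitable versions of the regression functions, 1. (common support, strong density) $P_{1,X},\dots,P_{m,X},Q_X$ have the same support $\Omega$ and are absolutely continuous with respect to Lebesgue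 measure $\lambda$, with densities lying strictly between $\mu_-$ and $\mu_+$ ($\lambda$-almost everywhere) on $\Omega$; and $\lambda(\Omega\cap B(x,r))\ge c_\mu\lambda(B(x,r))$ for all $x\in\Omega$, $0<r\le r_\mu$; 2. (smoothness) $|\eta_Q(x)-\eta_Q(x')|\le C_\beta\|x-x'\|^\beta$ for all $x,x'\in\Omega$; 3. (margin) $Q_X(|\eta_Q(X)-\tfrac12|\le t)\le C_\alpha t^\alpha$ for all $t>0$; 4. (relative signal exponent) $(\eta_{P_i}(x)-\tfrac12)(\eta_Q(x)-\tfrac12)\ge 0$ and $|\eta_{P_i}(x)-\tfrac12|\ge C_{\gamma_i}|\eta_Q(x)-\tfrac12|^{\gamma_i}$ for all $x\in\Omega$ and $1\le i\le m$. **The classifier.** Let $n_Q,n_{P_1},\dots,n_{P_m}\ge 0$ be sample sizes, not all zero, and observe independent samples consisting of $n_Q$ i.i.d. observations from $Q$ and $n_{P_i}$ i.i.d. observations from $P_i$, $1\le i\le m$. Put $$N=n_Q+\sum_{i=1}^m n_{P_i}^{\frac{2\beta+d}{2\gamma_i\beta+d}},\qquad w_Q=N^{-\frac{\beta}{2\beta+d}},\quad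 w_{P_i}=N^{-\frac{\gamma_i\beta}{2\beta+d}},\quad k_Q=\lfloor n_QN^{-\frac d{2\beta+d}}\rfloor,\quad k_{P_i}=\lfloor n_{P_i}N^{-\frac d{2\beta+d}}\rfloor .$$ With $Y^Q_{(j)}(x)$ and $Y^{P_i}_{(j)}(x)$ the label of the $j$-th nearest point to $x$ (Euclidean distance, ties broken by the index) in the target sample and in the $i$-th source sample, let $$\widehat\eta_{NN}(x)=\frac{w_Q\sum_{j=1}^{k_Q}Y^Q_{(j)}(x)+\sum_{i=1}^m w_{P_i}\sum_{j=1}^{k_{P_i}}Y^{P_i}_{(j)}(x)}{w_Qk_Q+\sum_{i=1}^m w_{P_i}k_{P_i}},\qquad \widehat f_{NN}(x)=\mathbf 1\{\widehat\eta_{NN}(x)>1/2\}$$ (with $0/0=0$). **Theorem (Upper Bound).** There is a constant $C>0$ not depending on $n_Q$ or $n_{P_1},\dots,n_{P_m}$ (it may depend on $d$, $m$ and the parameters and constants defining the class) such that for all such sample sizes $$\sup_{(P_1,\dots,P_m,Q)\in\Pi(\alpha,\beta,\gamma,\mu)}\mathbb E\,\mathcal E_Q(\widehat f_{NN})\le C\,m\Big(n_Q+\sum_{i=1}^m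 n_{P_i}^{\frac{2\beta+d}{2\gamma_i\beta+d}}\Big)^{-\frac{\beta(1+\alpha)}{2\beta+d}} .$$ -/

import Mathlib

open MeasureTheory ProbabilityTheory
open scoped BigOperators ENNReal

noncomputable section

namespace TransferKNN

/-- The covariate space `ℝ^d` with its Euclidean norm. -/
abbrev Cov (d : ℕ) : Type := EuclideanSpace ℝ (Fin d)

/-- A labelled observation `(X, Y)`; the label `true` stands for `1`, `false` for `0`. -/
abbrev Obs (d : ℕ) : Type := Cov d × Bool

/-- The numerical value of a label. -/
def labelVal (y : Bool) : ℝ := if y then 1 else 0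

/-! ### Distributions, regression functions, risks -/

/-- The regression function `η(x) = P(Y = 1 | X = x)` of a law `P` of `(X, Y)`
(some version of it; it is determined up to null sets of the marginal law `P.fst` of `X`). -/
def regression {d : ℕ} (P : Measure (Obs d)) [IsProbabilityMeasure P] (x : Cov d) : ℝ :=
  (P.condKernel x).real {true}

/-- The misclassification probability `P(f(X) ≠ Y)` of a classifier `f`. -/
def risk {d : ℕ} (P : Measure (Obs d)) (f : Cov d → Bool) : ℝ :=
  P.real {z | f z.1 ≠ z.2}

open Classical in
/-- The Bayes classifier `1{η(x) > 1/2}`. -/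
def bayes {d : ℕ} (P : Measure (Obs d)) [IsProbabilityMeasure P] (x : Cov d) : Bool :=
  decide (1 / 2 < regression P x)

/-- The excess risk of `f` with respect to the law `P`. -/
def excessRisk {d : ℕ} (P : Measure (Obs d)) [IsProbabilityMeasure P] (f : Cov d → Bool) : ℝ :=
  risk P f - risk P (bayes P)

/-! ### The class of distributions -/

/-- `(β, Cβ)`-smoothness of a function on a set. -/
def SmoothOn {d : ℕ} (β Cβ : ℝ) (S : Set (Cov d)) (η : Cov d → ℝ) : Prop :=
  ∀ x ∈ S, ∀ x' ∈ S, |η x - η x'| ≤ Cβ * ‖x - x'‖ ^ β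

/-- The margin condition for a regression function `η` under the law `QX` of the covariate. -/
def Margin {d : ℕ} (α Cα : ℝ) (QX : Measure (Cov d)) (η : Cov d → ℝ) : Prop :=
  ∀ t : ℝ, 0 < t → QX.real {x | |η x - 1 / 2| ≤ t} ≤ Cα * t ^ α

/-- The relative signal exponent condition on a set, with exponent `γ` and constant `Cγ`. -/
def RelativeSignal {d : ℕ} (γ Cγ : ℝ) (S : Set (Cov d)) (ηQ ηP : Cov d → ℝ) : Prop :=
  ∀ x ∈ S, 0 ≤ (ηP x - 1 / 2) * (ηQ x - 1 / 2) ∧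
    Cγ * |ηQ x - 1 / 2| ^ γ ≤ |ηP x - 1 / 2|

/-- The law `μ` on `ℝ^d` has support `S`, is absolutely continuous with respect to Lebesgue
measure, and its density lies strictly between `μlo` and `μhi` on `S`. -/
structure DensityOn {d : ℕ} (μlo μhi : ℝ) (S : Set (Cov d)) (μ : Measure (Cov d)) : Prop where
  support_eq : μ.support = S
  absolutelyContinuous : μ ≪ volume
  density_bounds : ∀ᵐ x ∂(volume.restrict S),
    ENNReal.ofReal μlo < μ.rnDeriv volume x ∧ μ.rnDeriv volume x < ENNReal.ofReal μhi

/-- Regularity of a set: it occupies a fixed proportion of each small ball centred in it. -/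
def RegularSet {d : ℕ} (cμ rμ : ℝ) (S : Set (Cov d)) : Prop :=
  ∀ x ∈ S, ∀ r : ℝ, 0 < r → r ≤ rμ →
    ENNReal.ofReal cμ * volume (Metric.closedBall x r) ≤ volume (S ∩ Metric.closedBall x r)

/-- Membership of `(P_1, …, P_m, Q)` in the class `Π(α, β, γ, μ)`, with all the constants
of the defining conditions displayed. The pointwise conditions are imposed on
versions `ηQ`, `ηP i` of the regression functions. -/
structure InClass {d m : ℕ} (α Cα β Cβ : ℝ) (γ Cγ : Fin m → ℝ) (μlo μhi cμ rμ : ℝ)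
    (P : Fin m → Measure (Obs d)) [∀ i, IsProbabilityMeasure (P i)]
    (Q : Measure (Obs d)) [IsProbabilityMeasure Q] : Prop where
  density_target : DensityOn μlo μhi Q.fst.support Q.fst
  density_source : ∀ i, DensityOn μlo μhi Q.fst.support (P i).fst
  regular : RegularSet cμ rμ Q.fst.support
  regression_conditions : ∃ (ηQ : Cov d → ℝ) (ηP : Fin m → Cov d → ℝ),
    ηQ =ᵐ[Q.fst] regression Q ∧
    (∀ i, ηP i =ᵐ[(P i).fst] regression (P i)) ∧
    SmoothOn β Cβ Q.fst.support ηQ ∧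
    Margin α Cα Q.fst ηQ ∧
    ∀ i, RelativeSignal (γ i) (Cγ i) Q.fst.support ηQ (ηP i)

/-! ### The classifier -/

/-- The quantity `n_Q + ∑ i, n_{P_i} ^ ((2β + d) / (2γ_iβ + d))`. -/
def effSize {m : ℕ} (d : ℕ) (β : ℝ) (γ : Fin m → ℝ) (nQ : ℕ) (nP : Fin m → ℕ) : ℝ :=
  (nQ : ℝ) + ∑ i, (nP i : ℝ) ^ ((2 * β + d) / (2 * γ i * β + d))

/-- The weight of a sample with exponent `g`, when the effective size is `N`
(`g = γ_i` for the `i`-th source sample, `g = 1` for the target sample). -/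
def weight (d : ℕ) (β g N : ℝ) : ℝ := N ^ (-(g * β) / (2 * β + d))

/-- The number of neighbours used in a sample of size `n`, when the effective size is `N`. -/
def numNeighbors (d : ℕ) (β N : ℝ) (n : ℕ) : ℕ :=
  ⌊(n : ℝ) * N ^ (-(d : ℝ) / (2 * β + d))⌋₊

open Classical in
/-- The number of sample points that come before the `j`-th one when the sample is ordered by
increasing distance to `x`, ties being broken by the index. Thus the points of rank `< k`
are the `k` nearest neighbours of `x`. -/
def nnRank {d n : ℕ} (S : Fin n → Obs d) (x : Cov d) (j : Fin n) : ℕ :=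
  (Finset.univ.filter fun l : Fin n =>
    dist (S l).1 x < dist (S j).1 x ∨ (dist (S l).1 x = dist (S j).1 x ∧ l < j)).card

open Classical in
/-- The sum `Y_(1)(x) + ⋯ + Y_(k)(x)` of the labels of the `k` nearest neighbours of `x`. -/
def nnLabelSum {d n : ℕ} (S : Fin n → Obs d) (k : ℕ) (x : Cov d) : ℝ :=
  ∑ j ∈ Finset.univ.filter (fun j : Fin n => nnRank S x j < k), labelVal (S j).2

/-- The data: a target sample of size `nQ` and source samples of sizes `nP i`. -/
abbrev Sample {m : ℕ} (d : ℕ) (nQ : ℕ) (nP : Fin m → ℕ) : Type :=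
  (Fin nQ → Obs d) × ((i : Fin m) → Fin (nP i) → Obs d)

/-- The weighted nearest neighbour estimate of the regression function. -/
def etaHat {d m : ℕ} (β : ℝ) (γ : Fin m → ℝ) {nQ : ℕ} {nP : Fin m → ℕ}
    (D : Sample d nQ nP) (x : Cov d) : ℝ :=
  let N := effSize d β γ nQ nP
  let wQ := weight d β 1 N
  let wP := fun i => weight d β (γ i) N
  let kQ := numNeighbors d β N nQ
  let kP := fun i => numNeighbors d β N (nP i)
  (wQ * nnLabelSum D.1 kQ x + ∑ i, wP i * nnLabelSum (D.2 i) (kP i) x) /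
    (wQ * (kQ : ℝ) + ∑ i, wP i * (kP i : ℝ))

open Classical in
/-- The weighted nearest neighbour classifier `1{etaHat(x) > 1/2}`. -/
def fHat {d m : ℕ} (β : ℝ) (γ : Fin m → ℝ) {nQ : ℕ} {nP : Fin m → ℕ}
    (D : Sample d nQ nP) (x : Cov d) : Bool :=
  decide (1 / 2 < etaHat β γ D x)

/-- The law of the data: all observations are independent, those of the target sample
have law `Q` and those of the `i`-th source sample have law `P i`. -/
def sampleLaw {d m : ℕ} (P : Fin m → Measure (Obs d)) (Q : Measure (Obs d))
    (nQ : ℕ) (nP : Fin m → ℕ) : Measure (Sample d nQ nP) :=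
  (Measure.pi fun _ : Fin nQ => Q).prod
    (Measure.pi fun i : Fin m => Measure.pi fun _ : Fin (nP i) => P i)

end TransferKNN

end

/-! Write `h = N ^ (-1 / (2β + d))` and list the target as one more sample, with exponent `1`. A
sample with exponent `g` has weight `h ^ (gβ)` and about `n h ^ d` neighbours, which lie within
distance of order `h`. The definition of `N` gives `n h ^ d h ^ (2gβ) ≤ 1` for every sample, so the
variance of the weighted vote is bounded; and some sample supplies a fixed share of `N`, for which
the same quantity is bounded below.

Suppose `|η_Q(x) - 1/2| = t h ^ β` with `t` large. By smoothness the target signal keeps its sign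
and half its size near `x`, so each source signal there has the same sign and size at least a
constant times `(t h ^ β / 2) ^ g`. The sample with a fixed share of `N` then shifts the mean of the
vote by a constant times `t ^ g0`, where `g0` bounds the exponents below. Given the covariates,
Hoeffding's inequality bounds the error probability by `exp (-c t ^ (2 g0))`. Chernoff's inequality
ensures that the neighbours are close; samples with too few neighbours for it to be useful carry so
little weight that they count as bounded noise. This is `exists_measure_score_le`.

The excess risk is the integral of `2 |η_Q - 1/2|` times the error probability. Dyadic peeling under
the margin condition (`integral_le_of_margin`) turns the pointwise bound into `h ^ (β(1 + α))`. A
bandwidth bounded below needs only the bound `1` on the excess risk. -/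

namespace TransferKNN

/-! ### Ranks of nearest neighbours -/

section Rank

variable {d n : ℕ}

/-- The point `l` comes before the point `j` in the order of increasing distance to `x`. -/
def Precedes (S : Fin n → Obs d) (x : Cov d) (l j : Fin n) : Prop :=
  dist (S l).1 x < dist (S j).1 x ∨ (dist (S l).1 x = dist (S j).1 x ∧ l < j)

open Classical in
lemma nnRank_eq (S : Fin n → Obs d) (x : Cov d) (j : Fin n) :
    nnRank S x j = (Finset.univ.filter fun l => Precedes S x l j).card := by
  unfold nnRank Precedes
  congr

lemma nnRank_congr {S S' : Fin n → Obs d} (h : ∀ j, (S j).1 = (S' j).1) (x : Cov d) (j : Fin n) :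
    nnRank S x j = nnRank S' x j := by
  simp only [nnRank, h]

lemma Precedes.trans {S : Fin n → Obs d} {x : Cov d} {i l j : Fin n}
    (hi : Precedes S x i l) (h : Precedes S x l j) : Precedes S x i j := by
  rcases hi with hi | ⟨hi, hi'⟩ <;> rcases h with h | ⟨h, h'⟩
  · exact Or.inl (hi.trans h)
  · exact Or.inl (h ▸ hi)
  · exact Or.inl (hi ▸ h)
  · exact Or.inr ⟨hi.trans h, hi'.trans h'⟩

lemma not_precedes_self (S : Fin n → Obs d) (x : Cov d) (j : Fin n) : ¬ Precedes S x j j := by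
  simp [Precedes]

lemma nnRank_lt_of_precedes {S : Fin n → Obs d} {x : Cov d} {l j : Fin n}
    (h : Precedes S x l j) : nnRank S x l < nnRank S x j := by
  classical
  rw [nnRank_eq, nnRank_eq]
  apply Finset.card_lt_card
  refine (Finset.ssubset_iff_of_subset ?_).2 ⟨l, by simpa using h, ?_⟩
  · intro i hi
    simp only [Finset.mem_filter, Finset.mem_univ, true_and] at hi ⊢
    exact hi.trans h
  · simpa using not_precedes_self S x l

lemma precedes_or_precedes {S : Fin n → Obs d} {x : Cov d} {l j : Fin n} (h : l ≠ j) :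
    Precedes S x l j ∨ Precedes S x j l := by
  unfold Precedes
  rcases lt_trichotomy (dist (S l).1 x) (dist (S j).1 x) with h1 | h1 | h1
  · exact Or.inl (Or.inl h1)
  · rcases lt_or_gt_of_ne h with h2 | h2
    · exact Or.inl (Or.inr ⟨h1, h2⟩)
    · exact Or.inr (Or.inr ⟨h1.symm, h2⟩)
  · exact Or.inr (Or.inl h1)

lemma nnRank_injective (S : Fin n → Obs d) (x : Cov d) : Function.Injective (nnRank S x) := by
  intro l j h
  by_contra hne
  rcases precedes_or_precedes (S := S) (x := x) hne with h' | h'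
  · exact (nnRank_lt_of_precedes h').ne h
  · exact (nnRank_lt_of_precedes h').ne' h

lemma nnRank_lt (S : Fin n → Obs d) (x : Cov d) (j : Fin n) : nnRank S x j < n := by
  classical
  rw [nnRank_eq]
  calc _ < (Finset.univ : Finset (Fin n)).card := by
        apply Finset.card_lt_card
        refine (Finset.ssubset_iff_of_subset (Finset.subset_univ _)).2 ⟨j, Finset.mem_univ _, ?_⟩
        simpa using not_precedes_self S x j
    _ = n := by simp

-- Ranks are injective with values below `n`, hence take each value `0, …, n - 1` exactly once.
open Classical in
lemma card_nnRank_lt (S : Fin n → Obs d) (x : Cov d) {k : ℕ} (hk : k ≤ n) :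
    (Finset.univ.filter fun j => nnRank S x j < k).card = k := by
  have hinj : Function.Injective fun j : Fin n => (⟨nnRank S x j, nnRank_lt S x j⟩ : Fin n) :=
    fun a b h => nnRank_injective S x (by simpa using h)
  have hbij : Function.Bijective fun j : Fin n => (⟨nnRank S x j, nnRank_lt S x j⟩ : Fin n) :=
    Finite.injective_iff_bijective.1 hinj
  calc _ = (Finset.range k).card := by
        refine Finset.card_bij (fun j _ => nnRank S x j) ?_ ?_ ?_
        · intro a ha
          simpa using ha
        · intro a _ b _ h
          exact nnRank_injective S x h
        · intro b hb
          have hb' : b < k := by simpa using hb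
          obtain ⟨j, hj⟩ := hbij.2 ⟨b, hb'.trans_le hk⟩
          have hj' : nnRank S x j = b := by simpa using hj
          exact ⟨j, by simpa [hj'] using hb', hj'⟩
    _ = k := by simp

-- A point outside the ball is preceded by every sample point in it, so its rank is at least `k`.
open Classical in
lemma dist_le_of_nnRank_lt {S : Fin n → Obs d} {x : Cov d} {k : ℕ} {r : ℝ}
    (hk : k ≤ (Finset.univ.filter fun j => (S j).1 ∈ Metric.closedBall x r).card)
    {j : Fin n} (hj : nnRank S x j < k) : dist (S j).1 x ≤ r := by
  by_contra! h
  have : (Finset.univ.filter fun j => (S j).1 ∈ Metric.closedBall x r).card ≤ nnRank S x j := by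
    rw [nnRank_eq]
    apply Finset.card_le_card
    intro l hl
    simp only [Finset.mem_filter, Finset.mem_univ, true_and, Metric.mem_closedBall] at hl ⊢
    exact Or.inl (hl.trans_lt h)
  omega

end Rank

/-! ### Measurability of the classifier -/

section Measurability

variable {d n : ℕ}

lemma measurable_nnRank (j : Fin n) :
    Measurable fun p : (Fin n → Obs d) × Cov d => nnRank p.1 p.2 j := by
  classical
  have hd : ∀ l : Fin n, Measurable fun p : (Fin n → Obs d) × Cov d => dist (p.1 l).1 p.2 := by
    intro l
    fun_prop
  have : (fun p : (Fin n → Obs d) × Cov d => nnRank p.1 p.2 j) =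
      fun p => ∑ l : Fin n, if Precedes p.1 p.2 l j then 1 else 0 := by
    funext p
    rw [nnRank_eq, Finset.card_filter]
  rw [this]
  refine Finset.measurable_sum _ fun l _ => Measurable.ite ?_ measurable_const measurable_const
  unfold Precedes
  exact (measurableSet_lt (hd l) (hd j)).union
    ((measurableSet_eq_fun (hd l) (hd j)).inter (MeasurableSet.const _))

lemma measurable_nnLabelSum (k : ℕ) :
    Measurable fun p : (Fin n → Obs d) × Cov d => nnLabelSum p.1 k p.2 := by
  classical
  have : (fun p : (Fin n → Obs d) × Cov d => nnLabelSum p.1 k p.2) =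
      fun p => ∑ j : Fin n, if nnRank p.1 p.2 j < k then labelVal (p.1 j).2 else 0 := by
    funext p
    rw [nnLabelSum, Finset.sum_filter]
  rw [this]
  refine Finset.measurable_sum _ fun j _ => Measurable.ite ?_ ?_ measurable_const
  · exact measurableSet_lt (measurable_nnRank j) measurable_const
  · have : Measurable labelVal := measurable_of_countable _
    exact this.comp (by fun_prop)

/-- Measurability jointly in the data and the point is what Fubini requires in
`integral_excessRisk`. -/
lemma measurable_fHat {m : ℕ} (β : ℝ) (γ : Fin m → ℝ) {nQ : ℕ} {nP : Fin m → ℕ} :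
    Measurable fun p : Sample d nQ nP × Cov d => fHat β γ p.1 p.2 := by
  classical
  have h1 : Measurable fun p : Sample d nQ nP × Cov d => etaHat β γ p.1 p.2 := by
    unfold etaHat
    refine Measurable.div_const (Measurable.add (Measurable.const_mul ?_ _)
      (Finset.measurable_sum _ fun i _ => Measurable.const_mul ?_ _)) _
    · exact (measurable_nnLabelSum _).comp (f := fun p : Sample d nQ nP × Cov d => (p.1.1, p.2))
        (by fun_prop)
    · exact (measurable_nnLabelSum _).comp (f := fun p : Sample d nQ nP × Cov d => (p.1.2 i, p.2))
        (by fun_prop)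
  have h2 : MeasurableSet {p : Sample d nQ nP × Cov d | 1 / 2 < etaHat β γ p.1 p.2} :=
    measurableSet_lt measurable_const h1
  refine measurable_to_bool ?_
  convert h2 using 1
  ext p
  simp [fHat]

end Measurability

/-! ### Representation of the data by covariates and uniform variables -/

/-- The uniform distribution on `[0, 1]`. -/
noncomputable def unif : Measure ℝ := volume.restrict (Set.Icc 0 1)

instance : IsProbabilityMeasure unif := ⟨by simp [unif]⟩

lemma unif_Iic {a : ℝ} (h1 : a ≤ 1) : unif (Set.Iic a) = ENNReal.ofReal a := by
  have : Set.Iic a ∩ Set.Icc 0 1 = Set.Icc 0 a := by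
    ext x
    simp only [Set.mem_inter_iff, Set.mem_Iic, Set.mem_Icc]
    constructor
    · rintro ⟨h, h', _⟩
      exact ⟨h', h⟩
    · rintro ⟨h, h'⟩
      exact ⟨h', h, h'.trans h1⟩
  rw [unif, Measure.restrict_apply measurableSet_Iic, this]
  simp

/-- The observation with covariate `z.1` whose label is `true` when `z.2 ≤ η z.1`. -/
noncomputable def threshold {d : ℕ} (η : Cov d → ℝ) (z : Cov d × ℝ) : Obs d :=
  (z.1, decide (z.2 ≤ η z.1))

section Representation

variable {d : ℕ}

lemma measurable_threshold {η : Cov d → ℝ} (hη : Measurable η) : Measurable (threshold η) := by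
  refine measurable_fst.prodMk (measurable_to_bool ?_)
  have : MeasurableSet {z : Cov d × ℝ | z.2 ≤ η z.1} :=
    measurableSet_le measurable_snd (hη.comp measurable_fst)
  convert this using 1
  ext p
  simp

variable (P : Measure (Obs d)) [IsProbabilityMeasure P]

lemma measurable_regression : Measurable (regression P) :=
  (Kernel.measurable_coe P.condKernel (measurableSet_singleton true)).ennreal_toReal

lemma regression_nonneg (x : Cov d) : 0 ≤ regression P x := measureReal_nonneg

lemma regression_le_one (x : Cov d) : regression P x ≤ 1 := measureReal_le_one

lemma condKernel_eq_map (x : Cov d) :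
    P.condKernel x = unif.map fun u => decide (u ≤ regression P x) := by
  have hm : Measurable fun u : ℝ => decide (u ≤ regression P x) := by
    refine measurable_to_bool ?_
    convert (measurableSet_Iic : MeasurableSet (Set.Iic (regression P x))) using 1
    ext p
    simp
  have : IsProbabilityMeasure (unif.map fun u : ℝ => decide (u ≤ regression P x)) :=
    Measure.isProbabilityMeasure_map hm.aemeasurable
  have key : (P.condKernel x) {true} =
      (unif.map fun u : ℝ => decide (u ≤ regression P x)) {true} := by
    rw [Measure.map_apply hm (measurableSet_singleton _)]
    have : (fun u : ℝ => decide (u ≤ regression P x)) ⁻¹' {true} = Set.Iic (regression P x) := by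
      ext p
      simp
    rw [this, unif_Iic (regression_le_one P x), regression,
      ofReal_measureReal]
  have hc : ({false} : Set Bool) = {true}ᶜ := by ext b; cases b <;> simp
  refine Measure.ext_of_singleton fun b => ?_
  cases b
  · rw [hc, prob_compl_eq_one_sub (measurableSet_singleton _),
      prob_compl_eq_one_sub (measurableSet_singleton _), key]
  · exact key

/-- Given `X = x` the label is Bernoulli with mean `η x`, as is the indicator of `U ≤ η x` for
uniform `U`. Conditioning on the covariates thus becomes slicing a product measure. -/
lemma eq_map_threshold : P = (P.fst.prod unif).map (threshold (regression P)) := by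
  have hm := measurable_threshold (measurable_regression P)
  refine Measure.ext fun A hA => ?_
  conv_lhs => rw [← P.disintegrate P.condKernel]
  rw [Measure.compProd_apply hA, Measure.map_apply hm hA, Measure.prod_apply (hm hA)]
  refine lintegral_congr fun x => ?_
  rw [condKernel_eq_map, Measure.map_apply]
  · rfl
  · exact measurable_snd.comp (hm.comp measurable_prodMk_left)
  · exact measurable_prodMk_left hA

end Representation

/-! ### The pooled sample as a function of independent covariates and uniform variables -/

section Pooled

variable {d : ℕ} {T : Type*}

/-- The pooled sample built from covariates `X` and thresholds `U`. -/
noncomputable def pooled {n : T → ℕ} (η : T → Cov d → ℝ)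
    (X : (Σ s, Fin (n s)) → Cov d) (U : (Σ s, Fin (n s)) → ℝ) (j : Σ s, Fin (n s)) : Obs d :=
  threshold (η j.1) (X j, U j)

variable (P : T → Measure (Obs d)) [∀ s, IsProbabilityMeasure (P s)] (n : T → ℕ)

lemma measurable_pooled : Measurable fun p : ((Σ s, Fin (n s)) → Cov d) × ((Σ s, Fin (n s)) → ℝ) =>
    pooled (fun s => regression (P s)) p.1 p.2 := by
  refine measurable_pi_lambda _ fun j => ?_
  exact (measurable_threshold (measurable_regression (P j.1))).comp (by fun_prop)

variable [Fintype T]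

/-- The law of the pooled covariates. -/
noncomputable def covLaw : Measure ((Σ s, Fin (n s)) → Cov d) := Measure.pi fun j => (P j.1).fst

/-- The law of the pooled thresholds. -/
noncomputable def unifLaw : Measure ((Σ s, Fin (n s)) → ℝ) := Measure.pi fun _ => unif

instance : IsProbabilityMeasure (covLaw P n) := by unfold covLaw; infer_instance
instance : IsProbabilityMeasure (unifLaw n) := by unfold unifLaw; infer_instance

lemma pi_eq_map_pooled :
    (Measure.pi fun j : Σ s, Fin (n s) => P j.1) =
      ((covLaw P n).prod (unifLaw n)).map
        fun p => pooled (fun s => regression (P s)) p.1 p.2 := by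
  have h1 := measurePreserving_arrowProdEquivProdArrow (Cov d) ℝ (Σ s, Fin (n s))
    (fun j => (P j.1).fst) (fun _ => unif)
  have hm : ∀ j : Σ s, Fin (n s), AEMeasurable (threshold (regression (P j.1)))
      ((P j.1).fst.prod unif) :=
    fun j => (measurable_threshold (measurable_regression (P j.1))).aemeasurable
  have : ∀ j : Σ s, Fin (n s), SigmaFinite
      (Measure.map (threshold (regression (P j.1))) ((P j.1).fst.prod unif)) := fun j => by
    rw [← eq_map_threshold]
    infer_instance
  have h2 := Measure.pi_map_pi hm
  unfold covLaw unifLaw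
  rw [← h1.map_eq, Measure.map_map (measurable_pooled P n) h1.measurable]
  have h3 : (Measure.pi fun j : Σ s, Fin (n s) => P j.1) =
      Measure.pi fun j : Σ s, Fin (n s) =>
        (Measure.map (threshold (regression (P j.1))) ((P j.1).fst.prod unif)) := by
    congr 1
    funext j
    exact eq_map_threshold (P j.1)
  rw [h3, ← h2]
  rfl

end Pooled

/-! ### The target and source samples as one independent family -/

section Flatten

variable {d m : ℕ} {nQ : ℕ} {nP : Fin m → ℕ}

/-- The sample sizes, with the target sample listed first. -/
def sizes (nQ : ℕ) (nP : Fin m → ℕ) (s : Option (Fin m)) : ℕ := s.elim nQ nP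

/-- The laws of the observations, with the target law listed first. -/
noncomputable def laws (P : Fin m → Measure (Obs d)) (Q : Measure (Obs d)) (s : Option (Fin m)) :
    Measure (Obs d) := s.elim Q P

instance (P : Fin m → Measure (Obs d)) (Q : Measure (Obs d)) [∀ i, IsProbabilityMeasure (P i)]
    [IsProbabilityMeasure Q] (s : Option (Fin m)) : IsProbabilityMeasure (laws P Q s) := by
  cases s
  · exact inferInstanceAs (IsProbabilityMeasure Q)
  · exact inferInstanceAs (IsProbabilityMeasure (P _))

/-- All the observations of a sample, in one family. -/
def flatten (D : Sample d nQ nP) : (Σ s, Fin (sizes nQ nP s)) → Obs d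
  | ⟨none, j⟩ => D.1 j
  | ⟨some i, j⟩ => D.2 i j

lemma measurable_flatten : Measurable (flatten : Sample d nQ nP → _) := by
  refine measurable_pi_lambda _ ?_
  rintro ⟨_ | i, j⟩
  · exact (measurable_pi_apply j).comp measurable_fst
  · exact (measurable_pi_apply j).comp ((measurable_pi_apply i).comp measurable_snd)

lemma map_flatten_sampleLaw (P : Fin m → Measure (Obs d)) (Q : Measure (Obs d))
    [∀ i, IsProbabilityMeasure (P i)] [IsProbabilityMeasure Q] :
    (sampleLaw P Q nQ nP).map flatten =
      Measure.pi fun j : Σ s, Fin (sizes nQ nP s) => laws P Q j.1 := by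
  symm
  refine Measure.pi_eq fun A hA => ?_
  rw [Measure.map_apply measurable_flatten (MeasurableSet.univ_pi hA)]
  have : flatten ⁻¹' (Set.univ.pi A) =
      (Set.univ.pi fun j : Fin nQ => A ⟨none, j⟩) ×ˢ
        (Set.univ.pi fun i : Fin m => Set.univ.pi fun j : Fin (nP i) => A ⟨some i, j⟩) := by
    ext D
    simp only [Set.mem_preimage, Set.mem_pi, Set.mem_univ, true_imp_iff, Set.mem_prod]
    constructor
    · exact fun h => ⟨fun j => h ⟨none, j⟩, fun i j => h ⟨some i, j⟩⟩
    · rintro ⟨h1, h2⟩ ⟨_ | i, j⟩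
      · exact h1 j
      · exact h2 i j
  rw [this, sampleLaw, Measure.prod_prod, Measure.pi_pi, Measure.pi_pi, Fintype.prod_sigma,
    Fintype.prod_option]
  simp only [Measure.pi_pi]
  rfl

end Flatten

/-! ### Concentration -/

section Hoeffding

lemma measurable_labelVal_threshold (a : ℝ) :
    Measurable fun u : ℝ => labelVal (decide (u ≤ a)) := by
  have h1 : Measurable fun u : ℝ => decide (u ≤ a) := by
    refine measurable_to_bool ?_
    convert (measurableSet_Iic : MeasurableSet (Set.Iic a)) using 1
    ext p
    simp
  exact (measurable_of_countable labelVal).comp h1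

lemma integral_labelVal_threshold {a : ℝ} (h0 : 0 ≤ a) (h1 : a ≤ 1) :
    ∫ u, labelVal (decide (u ≤ a)) ∂unif = a := by
  have : (fun u : ℝ => labelVal (decide (u ≤ a))) = (Set.Iic a).indicator 1 := by
    funext u
    by_cases h : u ≤ a <;> simp [labelVal, h]
  rw [this, integral_indicator_one measurableSet_Iic, measureReal_def, unif_Iic h1,
    ENNReal.toReal_ofReal h0]

lemma labelVal_mem_Icc (b : Bool) : labelVal b ∈ Set.Icc (0 : ℝ) 1 := by
  cases b <;> simp [labelVal]

variable {J : Type*} [Fintype J]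

/-- Hoeffding's inequality for a weighted vote of independent labels. -/
lemma measure_weighted_vote_le (c a : J → ℝ) (ha0 : ∀ j, 0 ≤ a j) (ha1 : ∀ j, a j ≤ 1)
    {σ : ℝ} (hσ : σ ^ 2 = 1) {V t : ℝ} (hV : ∑ j, c j ^ 2 ≤ V) (ht : 0 ≤ t)
    (h : t ≤ σ * ∑ j, c j * (a j - 1 / 2)) :
    (Measure.pi fun _ : J => unif).real
      {U | σ * ∑ j, c j * (labelVal (decide (U j ≤ a j)) - 1 / 2) ≤ 0} ≤
      Real.exp (-2 * t ^ 2 / V) := by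
  have hnn : 0 ≤ ∑ j, c j ^ 2 := Finset.sum_nonneg fun j _ => sq_nonneg _
  -- If all weights vanish, then `t = 0` and the bound is `1`. Otherwise the final comparison may
  -- divide by the sum of squares.
  rcases hnn.eq_or_lt with h0 | hpos
  · have hc : ∀ j, c j = 0 := fun j => by
      have := (Finset.sum_eq_zero_iff_of_nonneg fun j _ => sq_nonneg (c j)).1 h0.symm j
        (Finset.mem_univ j)
      simpa using this
    have : t = 0 := le_antisymm (by simpa [hc] using h) ht
    simp [this]
  -- These are the centred summands with the sign reversed: as the mean of the vote is at least `t`,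
  -- a vote `≤ 0` forces their sum to be at least `t`. Each one ranges over an interval of length
  -- `|c j|`, so its sub-Gaussian parameter is `c j ^ 2 / 4`.
  set X : J → (J → ℝ) → ℝ := fun j U =>
    (-(σ * c j)) * (labelVal (decide (U j ≤ a j)) - a j) with hX
  have hsub : ∀ j, HasSubgaussianMGF (X j)
      (⟨(-(σ * c j)) ^ 2, sq_nonneg _⟩ * (‖(1 : ℝ) - 0‖₊ / 2) ^ 2) (Measure.pi fun _ => unif) := by
    intro j
    refine HasSubgaussianMGF.const_mul ?_ _
    have h1 : HasSubgaussianMGF (fun u => labelVal (decide (u ≤ a j)) -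
        ∫ u, labelVal (decide (u ≤ a j)) ∂unif) ((‖(1 : ℝ) - 0‖₊ / 2) ^ 2) unif :=
      hasSubgaussianMGF_of_mem_Icc (measurable_labelVal_threshold (a j)).aemeasurable
        (Filter.Eventually.of_forall fun u => labelVal_mem_Icc _)
    rw [integral_labelVal_threshold (ha0 j) (ha1 j)] at h1
    rw [← (measurePreserving_eval (fun _ : J => unif) j).map_eq] at h1
    exact HasSubgaussianMGF.of_map (μ := Measure.pi fun _ : J => unif)
      (Y := Function.eval j) (measurable_pi_apply j).aemeasurable h1
  have hind : iIndepFun X (Measure.pi fun _ : J => unif) :=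
    iIndepFun_pi (X := fun j u => (-(σ * c j)) * (labelVal (decide (u ≤ a j)) - a j))
      fun j => (((measurable_labelVal_threshold (a j)).sub_const _).const_mul _).aemeasurable
  have key := HasSubgaussianMGF.measure_sum_ge_le_of_iIndepFun hind (s := Finset.univ)
    (fun j _ => hsub j) ht
  refine (measureReal_mono ?_).trans (key.trans (Real.exp_le_exp.2 ?_))
  · intro U hU
    simp only [Set.mem_ofPred_eq, hX] at hU ⊢
    have : ∑ j, -(σ * c j) * (labelVal (decide (U j ≤ a j)) - a j) =
        σ * ∑ j, c j * (a j - 1 / 2) -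
          σ * ∑ j, c j * (labelVal (decide (U j ≤ a j)) - 1 / 2) := by
      rw [Finset.mul_sum, Finset.mul_sum, ← Finset.sum_sub_distrib]
      exact Finset.sum_congr rfl fun j _ => by ring
    rw [this]
    linarith
  · have hsum : ((∑ j : J, (⟨(-(σ * c j)) ^ 2, sq_nonneg _⟩ * (‖(1 : ℝ) - 0‖₊ / 2) ^ 2 : NNReal) :
        NNReal) : ℝ) = (∑ j, c j ^ 2) / 4 := by
      rw [NNReal.coe_sum, Finset.sum_div]
      refine Finset.sum_congr rfl fun j _ => ?_
      change (-(σ * c j)) ^ 2 * (‖(1 : ℝ) - 0‖ / 2) ^ 2 = c j ^ 2 / 4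
      norm_num [mul_pow, hσ]
      ring
    rw [hsum, neg_mul, neg_div, neg_div, neg_le_neg_iff]
    calc 2 * t ^ 2 / V ≤ 2 * t ^ 2 / ∑ j, c j ^ 2 := by gcongr
      _ = t ^ 2 / (2 * ((∑ j, c j ^ 2) / 4)) := by field_simp; ring

end Hoeffding

/-! ### The number of covariates in a ball -/

section Chernoff

variable {d : ℕ} {T : Type*} (n : T → ℕ)

open Classical in
/-- The number of covariates of the sample `s` lying in `B`. -/
noncomputable def ballCount {n : T → ℕ} (s : T) (B : Set (Cov d))
    (X : (Σ s, Fin (n s)) → Cov d) : ℕ :=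
  (Finset.univ.filter fun j : Fin (n s) => X ⟨s, j⟩ ∈ B).card

lemma measurable_ballCount (s : T) {B : Set (Cov d)} (hB : MeasurableSet B) :
    Measurable fun X : (Σ s, Fin (n s)) → Cov d => ballCount s B X := by
  classical
  simp only [ballCount, Finset.card_filter]
  refine Finset.measurable_sum _ fun j _ => Measurable.ite ?_ measurable_const measurable_const
  exact measurable_pi_apply _ hB

variable [Fintype T] (P : T → Measure (Obs d)) [∀ s, IsProbabilityMeasure (P s)]

/-- Chernoff's inequality for the number of covariates in a set. -/
lemma measure_ballCount_lt_le (s : T) {B : Set (Cov d)} (hB : MeasurableSet B) (k : ℕ)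
    (hk : 4 * (k : ℝ) ≤ n s * (P s).fst.real B) :
    (covLaw P n).real {X | ballCount s B X < k} ≤ Real.exp (-k) := by
  classical
  -- The product of these factors is `exp (-ballCount)`; the other samples contribute `1`. With `p`
  -- the mass of `B`, its mean is `(1 - (1 - 1/e) p) ^ n ≤ exp (-n p / 2) ≤ exp (-2k)`, and Markov's
  -- inequality at level `exp (-k)` loses half of the exponent.
  set f : (Σ s, Fin (n s)) → Cov d → ℝ := fun j x =>
    if j.1 = s then Real.exp (-(B.indicator 1 x)) else 1 with hf
  have hprod : ∀ X : (Σ s, Fin (n s)) → Cov d,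
      ∏ j, f j (X j) = Real.exp (-(ballCount s B X : ℝ)) := by
    intro X
    rw [Fintype.prod_sigma, Finset.prod_eq_single s]
    · simp only [hf, if_true]
      rw [← Real.exp_sum, Finset.sum_neg_distrib, ballCount, Finset.card_filter]
      push_cast
      simp [Set.indicator_apply]
    · intro s' _ hs'
      simp [hf, hs']
    · simp
  have hint : ∫ X, Real.exp (-(ballCount s B X : ℝ)) ∂(covLaw P n) ≤ Real.exp (-(2 * k)) := by
    simp_rw [← hprod]
    rw [covLaw, integral_fintype_prod_eq_prod, Fintype.prod_sigma, Finset.prod_eq_single s]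
    · simp only [hf, if_true]
      have h1 : ∫ x, Real.exp (-(B.indicator (1 : Cov d → ℝ) x)) ∂(P s).fst =
          1 - (1 - Real.exp (-1)) * (P s).fst.real B := by
        have : (fun x => Real.exp (-(B.indicator (1 : Cov d → ℝ) x))) =
            fun x => 1 - (1 - Real.exp (-1)) * B.indicator (1 : Cov d → ℝ) x := by
          funext x
          by_cases hx : x ∈ B <;> simp [hx]
        rw [this, integral_sub (integrable_const _), integral_const_mul, integral_indicator_one hB]
        · simp
        · exact ((integrable_const (1 : ℝ)).indicator hB).const_mul _
      rw [h1, Finset.prod_const, Finset.card_univ, Fintype.card_fin]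
      have hp : (P s).fst.real B ≤ 1 := measureReal_le_one
      have hp0 : 0 ≤ (P s).fst.real B := measureReal_nonneg
      have he : Real.exp (-1) ≤ 1 / 2 := by
        rw [Real.exp_neg, one_div]
        refine inv_anti₀ (by norm_num) ?_
        linarith [Real.add_one_le_exp (1 : ℝ)]
      have he0 := Real.exp_pos (-1)
      calc (1 - (1 - Real.exp (-1)) * (P s).fst.real B) ^ n s
          ≤ Real.exp (-((P s).fst.real B / 2)) ^ n s := by
            refine pow_le_pow_left₀ (by nlinarith) ?_ _
            have := Real.add_one_le_exp (-((P s).fst.real B / 2))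
            nlinarith
        _ = Real.exp (-(n s * (P s).fst.real B / 2)) := by
            rw [← Real.exp_nat_mul]
            ring_nf
        _ ≤ _ := Real.exp_le_exp.2 (by linarith)
    · intro s' _ hs'
      simp [hf, hs']
    · simp
  have hmeas := measurable_ballCount (n := n) s hB
  have hmeas' : Measurable fun X : (Σ s, Fin (n s)) → Cov d =>
      Real.exp (-(ballCount s B X : ℝ)) :=
    Real.measurable_exp.comp ((measurable_from_nat (f := fun k : ℕ => (k : ℝ))).comp hmeas).neg
  have hmarkov := mul_meas_ge_le_integral_of_nonneg (μ := covLaw P n)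
    (f := fun X => Real.exp (-(ballCount s B X : ℝ)))
    (Filter.Eventually.of_forall fun X => (Real.exp_pos _).le)
    (Integrable.of_bound (C := 1) hmeas'.aestronglyMeasurable
      (Filter.Eventually.of_forall fun X => by simp)) (Real.exp (-(k : ℝ)))
  have hle : (covLaw P n).real {X | ballCount s B X < k} ≤
      (covLaw P n).real {X | Real.exp (-(k : ℝ)) ≤ Real.exp (-(ballCount s B X : ℝ))} := by
    refine measureReal_mono fun X hX => ?_
    simp only [Set.mem_ofPred_eq, Real.exp_le_exp, neg_le_neg_iff] at hX ⊢
    exact_mod_cast hX.le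
  have h2 : Real.exp (-(k : ℝ)) * (covLaw P n).real {X | ballCount s B X < k} ≤
      Real.exp (-(k : ℝ)) * Real.exp (-(k : ℝ)) := by
    rw [← Real.exp_add]
    calc _ ≤ _ := mul_le_mul_of_nonneg_left hle (Real.exp_pos _).le
      _ ≤ _ := hmarkov
      _ ≤ _ := hint
      _ = _ := by ring_nf
  exact le_of_mul_le_mul_left h2 (Real.exp_pos _)

end Chernoff

/-! ### The pooled vote at a point -/

section Score

variable {d : ℕ} {T : Type*}

open Classical in
/-- The weight of the `j`-th observation of the pooled sample in the vote at `x`. -/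
noncomputable def coef {n : T → ℕ} (w : T → ℝ) (k : T → ℕ) (X : (Σ s, Fin (n s)) → Cov d)
    (x : Cov d) (j : Σ s, Fin (n s)) : ℝ :=
  if nnRank (fun l => (X ⟨j.1, l⟩, true)) x j.2 < k j.1 then w j.1 else 0

variable [Fintype T]

/-- The weighted vote, centred at one half, of the nearest neighbours of `x`. -/
noncomputable def score {n : T → ℕ} (w : T → ℝ) (k : T → ℕ) (S : (Σ s, Fin (n s)) → Obs d)
    (x : Cov d) : ℝ :=
  ∑ s, w s * (nnLabelSum (fun j => S ⟨s, j⟩) (k s) x - k s / 2)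

variable {n : T → ℕ} {w : T → ℝ} {k : T → ℕ}

lemma measurable_score (x : Cov d) :
    Measurable fun S : (Σ s, Fin (n s)) → Obs d => score w k S x := by
  unfold score
  refine Finset.measurable_sum _ fun s _ => Measurable.const_mul (Measurable.sub_const ?_ _) _
  exact (measurable_nnLabelSum (k s)).comp
    (f := fun S : (Σ s, Fin (n s)) → Obs d => ((fun j => S ⟨s, j⟩ : Fin (n s) → Obs d), x))
    (by fun_prop)

open Classical in
lemma sum_coef_mul (X : (Σ s, Fin (n s)) → Cov d) (x : Cov d) (f : (Σ s, Fin (n s)) → ℝ) :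
    ∑ j, coef w k X x j * f j = ∑ s, w s *
      ∑ j ∈ Finset.univ.filter (fun j => nnRank (fun l => (X ⟨s, l⟩, true)) x j < k s),
        f ⟨s, j⟩ := by
  rw [Fintype.sum_sigma]
  refine Finset.sum_congr rfl fun s _ => ?_
  rw [Finset.sum_filter, Finset.mul_sum]
  refine Finset.sum_congr rfl fun j _ => ?_
  unfold coef
  split_ifs <;> simp

/-- Exactly `k s` points of sample `s` carry the weight `w s`, wherever the covariates lie; the
variance bound in Hoeffding's inequality is therefore deterministic. -/
lemma sum_coef_sq (hk : ∀ s, k s ≤ n s) (X : (Σ s, Fin (n s)) → Cov d) (x : Cov d) :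
    ∑ j, coef w k X x j ^ 2 = ∑ s, w s ^ 2 * k s := by
  classical
  have : ∀ j, coef w k X x j ^ 2 = coef w k X x j * w j.1 := by
    intro j
    unfold coef
    split_ifs <;> simp [sq]
  simp_rw [this]
  rw [sum_coef_mul]
  refine Finset.sum_congr rfl fun s _ => ?_
  simp only [Finset.sum_const, card_nnRank_lt _ x (hk s), nsmul_eq_mul]
  ring

lemma score_pooled (hk : ∀ s, k s ≤ n s) (η : T → Cov d → ℝ) (X : (Σ s, Fin (n s)) → Cov d)
    (U : (Σ s, Fin (n s)) → ℝ) (x : Cov d) :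
    score w k (pooled η X U) x =
      ∑ j, coef w k X x j * (labelVal (decide (U j ≤ η j.1 (X j))) - 1 / 2) := by
  classical
  rw [sum_coef_mul, score]
  refine Finset.sum_congr rfl fun s _ => ?_
  have hrank : ∀ j, nnRank (fun j => pooled η X U ⟨s, j⟩) x j =
      nnRank (fun l => (X ⟨s, l⟩, true)) x j := fun j => nnRank_congr (fun _ => rfl) x j
  rw [Finset.sum_sub_distrib, Finset.sum_const, card_nnRank_lt _ x (hk s), nnLabelSum]
  simp only [hrank, nsmul_eq_mul]
  congr 2
  ring

lemma le_sum_coef_mul (hk : ∀ s, k s ≤ n s) (hw : ∀ s, 0 ≤ w s) (X : (Σ s, Fin (n s)) → Cov d)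
    (x : Cov d) (f : (Σ s, Fin (n s)) → ℝ) (v : T → ℝ)
    (h : ∀ s j, nnRank (fun l => (X ⟨s, l⟩, true)) x j < k s → v s ≤ f ⟨s, j⟩) :
    ∑ s, w s * k s * v s ≤ ∑ j, coef w k X x j * f j := by
  classical
  rw [sum_coef_mul]
  refine Finset.sum_le_sum fun s _ => ?_
  rw [mul_assoc]
  refine mul_le_mul_of_nonneg_left ?_ (hw s)
  calc (k s : ℝ) * v s = ∑ j ∈ Finset.univ.filter
        (fun j => nnRank (fun l => (X ⟨s, l⟩, true)) x j < k s), v s := by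
        rw [Finset.sum_const, card_nnRank_lt _ x (hk s), nsmul_eq_mul]
    _ ≤ _ := Finset.sum_le_sum fun j hj => h s j (by simpa using hj)

open Classical in
/-- The probability that the vote at `x` goes against `σ`, when the samples in `L` have enough
points near `x` and their regression functions favour `σ` near `x`. -/
lemma measure_score_le (P : T → Measure (Obs d)) [∀ s, IsProbabilityMeasure (P s)]
    (hk : ∀ s, k s ≤ n s) (hw : ∀ s, 0 ≤ w s) (x : Cov d) (r : ℝ) {σ : ℝ} (hσ : σ ^ 2 = 1)
    (κ : T → ℝ) (L : Finset T)
    (hκ : ∀ s, ∀ᵐ y ∂(P s).fst, y ∈ Metric.closedBall x r → κ s ≤ σ * (regression (P s) y - 1 / 2))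
    (hL : ∀ s ∈ L, 4 * (k s : ℝ) ≤ n s * (P s).fst.real (Metric.closedBall x r))
    {V t : ℝ} (hV : ∑ s, w s ^ 2 * k s ≤ V) (ht : 0 ≤ t)
    (htκ : t ≤ ∑ s, w s * k s * (if s ∈ L then κ s else -(1 / 2))) :
    (Measure.pi fun j : Σ s, Fin (n s) => P j.1).real {S | σ * score w k S x ≤ 0} ≤
      Real.exp (-2 * t ^ 2 / V) + ∑ s ∈ L, Real.exp (-(k s : ℝ)) := by
  set B := Metric.closedBall x r with hB
  have hBm : MeasurableSet B := measurableSet_closedBall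
  have hSm : MeasurableSet {S : (Σ s, Fin (n s)) → Obs d | σ * score w k S x ≤ 0} :=
    measurableSet_le ((measurable_score x).const_mul σ) measurable_const
  set bad : Set ((Σ s, Fin (n s)) → Cov d) := ⋃ s ∈ L, {X | ballCount s B X < k s} with hbad
  have hbadm : MeasurableSet bad := Finset.measurableSet_biUnion _ fun s _ =>
    measurableSet_lt (measurable_ballCount n s hBm) measurable_const
  have hbadle : (covLaw P n).real bad ≤ ∑ s ∈ L, Real.exp (-(k s : ℝ)) := by
    refine (measureReal_biUnion_finset_le _ _).trans (Finset.sum_le_sum fun s hs => ?_)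
    exact measure_ballCount_lt_le n P s hBm (k s) (hL s hs)
  have hae : ∀ᵐ X ∂(covLaw P n), ∀ j, X j ∈ B →
      κ j.1 ≤ σ * (regression (P j.1) (X j) - 1 / 2) := by
    refine ae_all_iff.2 fun j => ?_
    exact (measurePreserving_eval (fun j : Σ s, Fin (n s) => (P j.1).fst) j).quasiMeasurePreserving.ae
      (hκ j.1)
  -- With the covariates frozen, the error probability is at most `1` on `bad`; off `bad`, the
  -- neighbours from the samples in `L` lie in the ball and Hoeffding's inequality applies.
  have hslice : ∀ᵐ X ∂(covLaw P n), unifLaw n (Prod.mk X ⁻¹'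
      ((fun p : ((Σ s, Fin (n s)) → Cov d) × ((Σ s, Fin (n s)) → ℝ) =>
        pooled (fun s => regression (P s)) p.1 p.2) ⁻¹' {S | σ * score w k S x ≤ 0})) ≤
      bad.indicator 1 X + ENNReal.ofReal (Real.exp (-2 * t ^ 2 / V)) := by
    filter_upwards [hae] with X hX
    by_cases hXb : X ∈ bad
    · rw [Set.indicator_of_mem hXb]
      exact prob_le_one.trans (by simp)
    rw [Set.indicator_of_notMem hXb, zero_add]
    refine (ENNReal.le_ofReal_iff_toReal_le (measure_ne_top _ _) (Real.exp_pos _).le).2 ?_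
    have hgood : ∀ s ∈ L, k s ≤ ballCount s B X := by
      simpa [hbad] using hXb
    have hlow : ∑ s, w s * k s * (if s ∈ L then κ s else -(1 / 2)) ≤
        ∑ j, coef w k X x j * (σ * (regression (P j.1) (X j) - 1 / 2)) := by
      refine le_sum_coef_mul hk hw X x _ _ fun s j hj => ?_
      split_ifs with hs
      · refine hX ⟨s, j⟩ ?_
        exact dist_le_of_nnRank_lt (S := fun l => (X ⟨s, l⟩, true)) (hgood s hs) hj
      -- Outside `L` the neighbours may be far away, and only `0 ≤ η ≤ 1` is used.
      · have h0 := regression_nonneg (P s) (X ⟨s, j⟩)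
        have h1 := regression_le_one (P s) (X ⟨s, j⟩)
        rcases mul_self_eq_one_iff.1 ((sq σ).symm.trans hσ) with h | h <;> subst h <;> linarith
    have := measure_weighted_vote_le (coef w k X x) (fun j => regression (P j.1) (X j))
      (fun j => regression_nonneg _ _) (fun j => regression_le_one _ _) hσ (V := V) (t := t)
      ((sum_coef_sq hk X x).trans_le hV) ht (by
        refine (htκ.trans hlow).trans_eq ?_
        rw [Finset.mul_sum]
        exact Finset.sum_congr rfl fun j _ => by ring)
    refine le_of_eq_of_le ?_ this
    rw [measureReal_def, unifLaw]
    congr 2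
    ext U
    simp only [Set.mem_preimage, Set.mem_ofPred_eq, score_pooled hk]
  have hmain : (Measure.pi fun j : Σ s, Fin (n s) => P j.1) {S | σ * score w k S x ≤ 0} ≤
      covLaw P n bad + ENNReal.ofReal (Real.exp (-2 * t ^ 2 / V)) := by
    rw [pi_eq_map_pooled, Measure.map_apply (measurable_pooled P n) hSm,
      Measure.prod_apply (measurable_pooled P n hSm)]
    refine (lintegral_mono_ae hslice).trans_eq ?_
    rw [lintegral_add_right _ measurable_const, lintegral_indicator_one hbadm]
    simp
  have := ENNReal.toReal_mono
    (ENNReal.add_ne_top.2 ⟨measure_ne_top _ _, ENNReal.ofReal_ne_top⟩) hmain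
  rw [ENNReal.toReal_add (measure_ne_top _ _) ENNReal.ofReal_ne_top,
    ENNReal.toReal_ofReal (Real.exp_pos _).le] at this
  rw [measureReal_def] at hbadle ⊢
  linarith

end Score

/-! ### The expected excess risk -/

section ExcessRisk

variable {d : ℕ} (Q : Measure (Obs d)) [IsProbabilityMeasure Q]

lemma condKernel_real_ne (b : Bool) (x : Cov d) :
    (Q.condKernel x).real {y | b ≠ y} = if b then 1 - regression Q x else regression Q x := by
  cases b
  · have : {y : Bool | false ≠ y} = {true} := by ext y; cases y <;> simp
    rw [this]
    rfl
  · have : {y : Bool | true ≠ y} = {true}ᶜ := by ext y; cases y <;> simp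
    rw [this, probReal_compl_eq_one_sub (measurableSet_singleton _)]
    rfl

lemma measurableSet_ne {f : Cov d → Bool} (hf : Measurable f) :
    MeasurableSet {z : Obs d | f z.1 ≠ z.2} :=
  (measurableSet_eq_fun (hf.comp measurable_fst) measurable_snd).compl

lemma risk_eq_integral {f : Cov d → Bool} (hf : Measurable f) :
    risk Q f = ∫ x, (if f x then 1 - regression Q x else regression Q x) ∂Q.fst := by
  have hA := measurableSet_ne hf
  have h1 : Q {z | f z.1 ≠ z.2} =
      ∫⁻ x, Q.condKernel x (Prod.mk x ⁻¹' {z | f z.1 ≠ z.2}) ∂Q.fst := by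
    conv_lhs => rw [← Q.disintegrate Q.condKernel]
    exact Measure.compProd_apply hA
  rw [risk, measureReal_def, h1, ← integral_toReal
    (Kernel.measurable_kernel_prodMk_left hA).aemeasurable
    (Filter.Eventually.of_forall fun x => measure_lt_top _ _)]
  refine integral_congr_ae (Filter.Eventually.of_forall fun x => ?_)
  exact condKernel_real_ne Q (f x) x

lemma measurable_bayes : Measurable (bayes Q) := by
  refine measurable_to_bool ?_
  convert measurableSet_lt (measurable_const (a := (1 / 2 : ℝ))) (measurable_regression Q) using 1
  ext x
  simp [bayes]

-- At a point of disagreement the conditional error probabilities are `η` and `1 - η`, which differ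
-- by `2 |η - 1/2|`, and the Bayes rule has the smaller one.
open Classical in
lemma excessRisk_eq_integral {f : Cov d → Bool} (hf : Measurable f) :
    excessRisk Q f =
      ∫ x, (if f x ≠ bayes Q x then 2 * |regression Q x - 1 / 2| else 0) ∂Q.fst := by
  have hint : ∀ g : Cov d → Bool, Measurable g →
      Integrable (fun x => if g x then 1 - regression Q x else regression Q x) Q.fst := by
    intro g hg
    have hm := measurable_regression Q
    refine Integrable.of_bound (C := 1) (Measurable.ite (hg (measurableSet_singleton true))
      (measurable_const.sub hm) hm).aestronglyMeasurable (Filter.Eventually.of_forall fun x => ?_)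
    have h0 := regression_nonneg Q x
    have h1 := regression_le_one Q x
    split_ifs <;> rw [Real.norm_eq_abs, abs_le] <;> constructor <;> linarith
  rw [excessRisk, risk_eq_integral Q hf, risk_eq_integral Q (measurable_bayes Q),
    ← integral_sub (hint f hf) (hint _ (measurable_bayes Q))]
  refine integral_congr_ae (Filter.Eventually.of_forall fun x => ?_)
  by_cases hb : 1 / 2 < regression Q x
  · have : bayes Q x = true := by simpa [bayes] using hb
    simp only [this]
    rw [abs_of_pos (by linarith)]
    cases f x <;> simp
    ring
  · have : bayes Q x = false := by simpa [bayes] using hb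
    simp only [this]
    rw [abs_of_nonpos (by linarith)]
    cases f x <;> simp
    ring

lemma excessRisk_le_one (f : Cov d → Bool) : excessRisk Q f ≤ 1 := by
  have h1 : risk Q f ≤ 1 := measureReal_le_one
  have h2 : 0 ≤ risk Q (bayes Q) := measureReal_nonneg
  unfold excessRisk
  linarith

variable {Ω : Type*} [MeasurableSpace Ω] (μ : Measure Ω) [IsProbabilityMeasure μ]
  {F : Ω → Cov d → Bool} (hF : Measurable fun p : Ω × Cov d => F p.1 p.2)

include hF

open Classical in
lemma integrable_uncurry_error :
    Integrable (Function.uncurry fun (D : Ω) (x : Cov d) =>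
      if F D x ≠ bayes Q x then 2 * |regression Q x - 1 / 2| else 0) (μ.prod Q.fst) := by
  have hm : Measurable (Function.uncurry fun (D : Ω) (x : Cov d) =>
      if F D x ≠ bayes Q x then 2 * |regression Q x - 1 / 2| else 0) := by
    refine Measurable.ite ?_ ?_ measurable_const
    · exact (measurableSet_eq_fun hF ((measurable_bayes Q).comp measurable_snd)).compl
    · exact (((measurable_regression Q).sub_const _).abs.const_mul 2).comp measurable_snd
  refine Integrable.of_bound (C := 1) hm.aestronglyMeasurable
    (Filter.Eventually.of_forall fun p => ?_)
  have h0 := regression_nonneg Q p.2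
  have h1 := regression_le_one Q p.2
  have h2 : |regression Q p.2 - 1 / 2| ≤ 1 / 2 := by rw [abs_le]; constructor <;> linarith
  rw [Function.uncurry]
  split_ifs
  · rw [Real.norm_of_nonneg (by positivity)]
    linarith
  · simp

lemma integrable_excessRisk : Integrable (fun D => excessRisk Q (F D)) μ := by
  have := (integrable_uncurry_error Q μ hF).integral_prod_left
  refine this.congr (Filter.Eventually.of_forall fun D => ?_)
  exact (excessRisk_eq_integral Q (hF.comp measurable_prodMk_left)).symm

lemma integral_excessRisk :
    ∫ D, excessRisk Q (F D) ∂μ =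
      ∫ x, 2 * |regression Q x - 1 / 2| * μ.real {D | F D x ≠ bayes Q x} ∂Q.fst := by
  classical
  have h1 : ∀ D, excessRisk Q (F D) =
      ∫ x, (if F D x ≠ bayes Q x then 2 * |regression Q x - 1 / 2| else 0) ∂Q.fst :=
    fun D => excessRisk_eq_integral Q (hF.comp measurable_prodMk_left)
  simp_rw [h1]
  rw [integral_integral_swap (integrable_uncurry_error Q μ hF)]
  refine integral_congr_ae (Filter.Eventually.of_forall fun x => ?_)
  have hm : MeasurableSet {D | F D x ≠ bayes Q x} :=
    (measurableSet_eq_fun (hF.comp measurable_prodMk_right) measurable_const).compl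
  have : (fun D => if F D x ≠ bayes Q x then 2 * |regression Q x - 1 / 2| else 0) =
      {D | F D x ≠ bayes Q x}.indicator fun _ => 2 * |regression Q x - 1 / 2| := by
    funext D
    simp [Set.indicator_apply]
  simp only [this]
  rw [integral_indicator_const _ hm, smul_eq_mul, mul_comm]

end ExcessRisk

/-! ### Dyadic peeling under the margin condition -/

section MarginIntegral

/-- Integration of a rapidly decreasing function of the signal under a margin condition. -/
lemma integral_le_of_margin {E : Type*} [MeasurableSpace E] (ν : Measure E) [IsProbabilityMeasure ν]
    {Δ ψ : E → ℝ} (hΔ : Measurable Δ) (hψ : AEStronglyMeasurable ψ ν) {α Cα K u : ℝ} (hα : 0 ≤ α)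
    (hCα : 0 < Cα) (hK : 0 ≤ K) (hu : 0 < u)
    (hmargin : ∀ t : ℝ, 0 < t → ν.real {x | Δ x ≤ t} ≤ Cα * t ^ α)
    (hψ0 : ∀ x, 0 ≤ ψ x) (hψ1 : ∀ᵐ x ∂ν, ψ x ≤ K * Δ x)
    (hψ2 : ∀ᵐ x ∂ν, u ≤ Δ x → ψ x ≤ K * Δ x * (Δ x / u) ^ (-(2 + α))) :
    ∫ x, ψ x ∂ν ≤ K * Cα * 2 ^ (3 + α) * u ^ (1 + α) := by
  have h2 : (0 : ℝ) < 2 := two_pos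
  -- The number `a j` bounds `ψ` on the shell where `Δ` is between `2 ^ (j - 1) * u` and `2 ^ j *
  -- u`, and `a 0` bounds it where `Δ < u`. Of the decay exponent `2 + α`, one unit offsets the
  -- factor `Δ`, `α` offsets the growth of the margin bound, and the last unit leaves the geometric
  -- series in `1 / 2`.
  set a : ℕ → ℝ := fun j => K * 2 ^ (2 + α) * u * ((2 : ℝ) ^ j) ^ (-(1 + α)) with ha
  have ha0 : ∀ j, 0 ≤ a j := fun j => by positivity
  have hmeas : ∀ j : ℕ, MeasurableSet {x | Δ x ≤ 2 ^ j * u} := fun j =>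
    measurableSet_le hΔ measurable_const
  have hpt : ∀ᵐ x ∂ν, ENNReal.ofReal (ψ x) ≤
      ∑' j, {x | Δ x ≤ 2 ^ j * u}.indicator (fun _ => ENNReal.ofReal (a j)) x := by
    filter_upwards [hψ1, hψ2] with x h1 h2'
    rcases le_or_gt u (Δ x) with hux | hux
    · obtain ⟨j, hj1, hj2⟩ := exists_nat_pow_near ((one_le_div hu).2 hux) one_lt_two
      have hle : Δ x ≤ 2 ^ (j + 1) * u := ((div_lt_iff₀ hu).1 hj2).le
      refine le_trans ?_ (ENNReal.le_tsum (j + 1))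
      rw [Set.indicator_of_mem (by exact hle)]
      refine ENNReal.ofReal_le_ofReal ((h2' hux).trans ?_)
      have hpow : (Δ x / u) ^ (-(2 + α)) ≤ ((2 : ℝ) ^ j) ^ (-(2 + α)) :=
        Real.rpow_le_rpow_of_nonpos (by positivity) hj1 (by linarith)
      calc K * Δ x * (Δ x / u) ^ (-(2 + α))
          ≤ K * (2 ^ (j + 1) * u) * ((2 : ℝ) ^ j) ^ (-(2 + α)) := by
            have : 0 ≤ (Δ x / u) ^ (-(2 + α)) := Real.rpow_nonneg (div_nonneg (hu.le.trans hux) hu.le) _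
            gcongr
        _ = a (j + 1) := by
            have e1 : ((2 : ℝ) ^ (j + 1)) ^ (-(1 + α)) =
                2 ^ (j + 1) * (((2 : ℝ) ^ j) ^ (-(2 + α)) * 2 ^ (-(2 + α))) := by
              rw [← Real.mul_rpow (by positivity) (by positivity), ← pow_succ]
              nth_rewrite 2 [← Real.rpow_one ((2 : ℝ) ^ (j + 1))]
              rw [← Real.rpow_add (by positivity)]
              congr 1
              ring
            have e2 : (2 : ℝ) ^ (2 + α) * 2 ^ (-(2 + α)) = 1 := by
              rw [← Real.rpow_add h2]
              simp
            rw [ha]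
            simp only
            rw [e1]
            linear_combination -(K * (2 ^ (j + 1) * u) * ((2 : ℝ) ^ j) ^ (-(2 + α))) * e2
    · refine le_trans ?_ (ENNReal.le_tsum 0)
      rw [Set.indicator_of_mem (by simpa using hux.le)]
      refine ENNReal.ofReal_le_ofReal (h1.trans ?_)
      have : (1 : ℝ) ≤ 2 ^ (2 + α) := Real.one_le_rpow one_le_two (by linarith)
      calc K * Δ x ≤ K * u := by gcongr
        _ = K * 1 * u := by ring
        _ ≤ K * 2 ^ (2 + α) * u := by gcongr
        _ = a 0 := by simp [ha]
  have hR : 0 ≤ K * Cα * 2 ^ (3 + α) * u ^ (1 + α) := by positivity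
  rw [integral_eq_lintegral_of_nonneg_ae (Filter.Eventually.of_forall hψ0) hψ]
  refine ENNReal.toReal_le_of_le_ofReal hR ?_
  calc ∫⁻ x, ENNReal.ofReal (ψ x) ∂ν
      ≤ ∫⁻ x, ∑' j, {x | Δ x ≤ 2 ^ j * u}.indicator (fun _ => ENNReal.ofReal (a j)) x ∂ν :=
        lintegral_mono_ae hpt
    _ = ∑' j, ENNReal.ofReal (a j) * ν {x | Δ x ≤ 2 ^ j * u} := by
        rw [lintegral_tsum fun j => (measurable_const.indicator (hmeas j)).aemeasurable]
        exact tsum_congr fun j => lintegral_indicator_const (hmeas j) _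
    _ ≤ ∑' j : ℕ, ENNReal.ofReal (K * Cα * 2 ^ (2 + α) * u ^ (1 + α) * (1 / 2) ^ j) := by
        refine ENNReal.tsum_le_tsum fun j => ?_
        rw [← ofReal_measureReal, ← ENNReal.ofReal_mul (ha0 j)]
        refine ENNReal.ofReal_le_ofReal ?_
        calc a j * ν.real {x | Δ x ≤ 2 ^ j * u} ≤ a j * (Cα * (2 ^ j * u) ^ α) :=
              mul_le_mul_of_nonneg_left (hmargin _ (by positivity)) (ha0 j)
          _ = _ := by
              have e1 : ((2 : ℝ) ^ j) ^ (-(1 + α)) * ((2 : ℝ) ^ j) ^ α = (1 / 2) ^ j := by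
                rw [← Real.rpow_add (by positivity)]
                rw [show -(1 + α) + α = -1 by ring, Real.rpow_neg_one]
                simp
              have e2 : u ^ (1 + α) = u * u ^ α := by
                rw [Real.rpow_add hu, Real.rpow_one]
              rw [ha, Real.mul_rpow (by positivity) hu.le, e2]
              simp only
              linear_combination (K * Cα * 2 ^ (2 + α) * u * u ^ α) * e1
    _ = ENNReal.ofReal (K * Cα * 2 ^ (3 + α) * u ^ (1 + α)) := by
        rw [← ENNReal.ofReal_tsum_of_nonneg (fun j => by positivity)
          (summable_geometric_two.mul_left _), tsum_mul_left, tsum_geometric_two]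
        congr 1
        rw [show (3 : ℝ) + α = 2 + α + 1 by ring, Real.rpow_add h2 (2 + α) 1, Real.rpow_one]
        ring

end MarginIntegral

/-! ### The error probability at a point -/

section Ball

variable {d : ℕ}

/-- The density exceeds `μlo` on `S`, and `S` fills a share `cμ` of the ball. The constant `b`
precedes the law, so the radius chosen from it later is uniform over the class. -/
lemma exists_mul_pow_le_measure_closedBall {μlo cμ : ℝ} (hμlo : 0 < μlo) (hcμ : 0 < cμ) :
    ∃ b : ℝ, 0 < b ∧ ∀ (μhi rμ : ℝ) (S : Set (Cov d)) (μ : Measure (Cov d)) [IsFiniteMeasure μ],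
      DensityOn μlo μhi S μ → RegularSet cμ rμ S → ∀ x ∈ S, ∀ r : ℝ, 0 < r → r ≤ rμ →
        b * r ^ d ≤ μ.real (Metric.closedBall x r) := by
  refine ⟨μlo * cμ * (volume : Measure (Cov d)).real (Metric.ball 0 1), ?_, ?_⟩
  · have : 0 < (volume : Measure (Cov d)).real (Metric.ball 0 1) :=
      ENNReal.toReal_pos (Metric.measure_ball_pos _ _ one_pos).ne' measure_ball_lt_top.ne
    positivity
  intro μhi rμ S μ _ hD hR x hx r hr hrμ
  have h1 : ENNReal.ofReal μlo * volume (S ∩ Metric.closedBall x r) ≤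
      μ (Metric.closedBall x r) := by
    calc ENNReal.ofReal μlo * volume (S ∩ Metric.closedBall x r)
        = ∫⁻ _ in S ∩ Metric.closedBall x r, ENNReal.ofReal μlo := by simp
      _ ≤ ∫⁻ y in S ∩ Metric.closedBall x r, μ.rnDeriv volume y := by
          refine lintegral_mono_ae ?_
          have := ae_restrict_of_ae_restrict_of_subset
            (Set.inter_subset_left (t := Metric.closedBall x r)) hD.density_bounds
          filter_upwards [this] with y hy
          exact hy.1.le
      _ ≤ μ (S ∩ Metric.closedBall x r) := Measure.setLIntegral_rnDeriv_le _
      _ ≤ _ := measure_mono Set.inter_subset_right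
  have h2 := (mul_le_mul_right (hR x hx r hr hrμ) (ENNReal.ofReal μlo)).trans h1
  rw [Measure.addHaar_closedBall _ _ hr.le] at h2
  have h3 := ENNReal.toReal_mono (measure_ne_top _ _) h2
  simp only [ENNReal.toReal_mul, ENNReal.toReal_ofReal hμlo.le, ENNReal.toReal_ofReal hcμ.le,
    finrank_euclideanSpace, Fintype.card_fin, ENNReal.toReal_ofReal (pow_nonneg hr.le d)] at h3
  calc _ = μlo * (cμ * (r ^ d * (volume (Metric.ball (0 : Cov d) 1)).toReal)) := by
        rw [measureReal_def]
        ring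
    _ ≤ _ := h3

end Ball

lemma exists_pos_forall_le {T : Type*} [Finite T] {f : T → ℝ} (hf : ∀ s, 0 < f s) :
    ∃ c : ℝ, 0 < c ∧ ∀ s, c ≤ f s := by
  cases isEmpty_or_nonempty T
  · exact ⟨1, one_pos, fun s => isEmptyElim s⟩
  · obtain ⟨s, hs⟩ := Finite.exists_min f
    exact ⟨f s, hf s, hs⟩

/-- Raise `y / q ≤ exp (y / q)` to the power `q`. This trades exponential bounds for the powers that
the rate requires. -/
lemma exp_neg_le_rpow {q : ℝ} (hq : 0 < q) {y : ℝ} (hy : 0 < y) :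
    Real.exp (-y) ≤ q ^ q * y ^ (-q) := by
  have h1 : y / q ≤ Real.exp (y / q) := by linarith [Real.add_one_le_exp (y / q)]
  have h2 : (y / q) ^ q ≤ Real.exp y := by
    calc (y / q) ^ q ≤ Real.exp (y / q) ^ q := Real.rpow_le_rpow (by positivity) h1 hq.le
      _ = Real.exp y := by rw [← Real.exp_mul, div_mul_cancel₀ _ hq.ne']
  have h3 : q ^ q * y ^ (-q) = ((y / q) ^ q)⁻¹ := by
    rw [Real.div_rpow hy.le hq.le, Real.rpow_neg hy.le, inv_div]
    rfl
  rw [h3, Real.exp_neg]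
  exact inv_anti₀ (by positivity) h2

/-- The lower bound on a regression function near `x` that follows from the smoothness of the
target regression function and from the relative signal condition. -/
lemma signal_lower_bound {d : ℕ} {β Cβ g c : ℝ} (hg : 0 < g) (hc : 0 < c) (hβ : 0 < β)
    (hCβ : 0 < Cβ)
    {S : Set (Cov d)} {ηQ ηP : Cov d → ℝ} (hsmooth : SmoothOn β Cβ S ηQ)
    (hsig : RelativeSignal g c S ηQ ηP) {x y : Cov d} (hx : x ∈ S) (hy : y ∈ S) {r σ a : ℝ}
    (hσ : σ ^ 2 = 1) (hxy : dist y x ≤ r) (hr : 2 * (Cβ * r ^ β) ≤ a) (ha : 0 < a)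
    (hxa : σ * (ηQ x - 1 / 2) = a) : c * (a / 2) ^ g ≤ σ * (ηP y - 1 / 2) := by
  have h1 : |ηQ x - ηQ y| ≤ Cβ * r ^ β := by
    refine (hsmooth x hx y hy).trans ?_
    rw [← dist_eq_norm, dist_comm]
    gcongr
  -- By `hr`, smoothness moves the signal by at most `a / 2` within the ball.
  have h2 : a / 2 ≤ σ * (ηQ y - 1 / 2) := by
    have : σ * (ηQ x - ηQ y) ≤ |ηQ x - ηQ y| := by
      rcases mul_self_eq_one_iff.1 ((sq σ).symm.trans hσ) with h | h <;> subst h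
      · simpa using le_abs_self (ηQ x - ηQ y)
      · simpa using neg_le_abs (ηQ x - ηQ y)
    nlinarith
  obtain ⟨h3, h4⟩ := hsig y hy
  have habs : ∀ z : ℝ, |z| = |σ * z| := fun z => by
    have : |σ| = 1 := by
      rw [← sq_eq_sq₀ (abs_nonneg _) zero_le_one, sq_abs, hσ, one_pow]
    rw [abs_mul, this, one_mul]
  have h5 : 0 ≤ σ * (ηP y - 1 / 2) := by
    have : 0 ≤ (σ * (ηP y - 1 / 2)) * (σ * (ηQ y - 1 / 2)) := by
      calc (0 : ℝ) ≤ σ ^ 2 * ((ηP y - 1 / 2) * (ηQ y - 1 / 2)) := by rw [hσ, one_mul]; exact h3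
        _ = _ := by ring
    exact nonneg_of_mul_nonneg_left this (by linarith)
  rw [habs (ηP y - 1 / 2), abs_of_nonneg h5, habs (ηQ y - 1 / 2),
    abs_of_nonneg (by linarith : 0 ≤ σ * (ηQ y - 1 / 2))] at h4
  refine le_trans ?_ h4
  gcongr

/-! ### Signal against noise at a point -/

section Pointwise

variable {d : ℕ} {T : Type*} [Fintype T]

/-- The total signal of the neighbours when the bandwidth `h` is small: a sample with many
neighbours contributes its signal, a sample with few neighbours is treated as noise. -/
lemma le_sum_signal (k : T → ℕ) {g c : T → ℝ} {g0 c0 a1 β h t : ℝ} (hβ : 0 < β) (hg0 : 0 < g0)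
    (hc0 : 0 < c0) (ha1 : 0 < a1) (hgg : ∀ s, g0 ≤ g s) (hcc : ∀ s, c0 ≤ c s)
    (hh : 0 < h) (hh1 : h ≤ 1) (ht : 2 ≤ t)
    (hsmall : h ^ (g0 * β / 2) ≤ a1)
    (hsmall' : Fintype.card T * h ^ (g0 * β / 2) ≤ a1 * c0 / 2)
    (s₀ : T) (hs₀ : a1 ≤ k s₀ * h ^ (2 * (g s₀ * β))) :
    a1 * c0 / 2 * (t / 2) ^ g0 ≤ ∑ s, h ^ (g s * β) * k s *
      (open Classical in if s ∈ (Finset.univ.filter fun s => 1 ≤ k s * h ^ (g s * β / 2))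
        then c s * (t * h ^ β / 2) ^ (g s) else -(1 / 2)) := by
  classical
  set θ := h ^ (g0 * β / 2) with hθ
  have hθ0 : 0 < θ := by positivity
  have ht2 : 1 ≤ t / 2 := by linarith
  have hκ : ∀ s, c s * (t * h ^ β / 2) ^ (g s) = c s * (t / 2) ^ (g s) * h ^ (g s * β) := by
    intro s
    rw [show t * h ^ β / 2 = t / 2 * h ^ β by ring,
      Real.mul_rpow (by positivity) (by positivity), ← Real.rpow_mul hh.le, mul_comm β (g s)]
    ring
  have hle : ∀ s, h ^ (g s * β / 2) ≤ θ := fun s =>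
    Real.rpow_le_rpow_of_exponent_ge hh hh1 (by have := hgg s; gcongr)
  have hcpos : ∀ s, 0 < c s := fun s => hc0.trans_le (hcc s)
  -- Samples in the filter contribute nonnegatively. Any other has total weight at most `θ`, hence
  -- does harm at most `θ / 2`. The sample `s₀` supplies the main term.
  have hterm : ∀ s, (if s = s₀ then a1 * c0 * (t / 2) ^ g0 else 0) - θ / 2 ≤
      h ^ (g s * β) * k s * (if s ∈ (Finset.univ.filter fun s => 1 ≤ k s * h ^ (g s * β / 2))
        then c s * (t * h ^ β / 2) ^ (g s) else -(1 / 2)) := by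
    intro s
    by_cases hs : 1 ≤ k s * h ^ (g s * β / 2)
    · rw [if_pos (Finset.mem_filter.2 ⟨Finset.mem_univ s, hs⟩), hκ]
      have hc := hcpos s
      by_cases hss : s = s₀
      · subst hss
        rw [if_pos rfl]
        have e : h ^ (g s * β) * h ^ (g s * β) = h ^ (2 * (g s * β)) := by
          rw [← Real.rpow_add hh]
          ring_nf
        calc a1 * c0 * (t / 2) ^ g0 - θ / 2 ≤ a1 * c0 * (t / 2) ^ g0 := by linarith
          _ ≤ (k s * h ^ (2 * (g s * β))) * c s * (t / 2) ^ (g s) := by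
            have h1 := hcc s
            have h2 := Real.rpow_le_rpow_of_exponent_le ht2 (hgg s)
            gcongr
          _ = _ := by rw [← e]; ring
      · rw [if_neg hss]
        have : 0 ≤ h ^ (g s * β) * k s * (c s * (t / 2) ^ (g s) * h ^ (g s * β)) := by positivity
        linarith
    · have hmem : s ∉ Finset.univ.filter fun s => 1 ≤ k s * h ^ (g s * β / 2) := by
        rw [Finset.mem_filter]
        exact fun h => hs h.2
      rw [if_neg hmem]
      have e : h ^ (g s * β) = h ^ (g s * β / 2) * h ^ (g s * β / 2) := by
        rw [← Real.rpow_add hh]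
        ring_nf
      have hpos : 0 < h ^ (g s * β / 2) := by positivity
      -- The sample `s₀` passes the filter: `θ ≤ a1 ≤ k h ^ (2gβ) ≤ k h ^ (gβ / 2) θ`.
      have hss : s ≠ s₀ := by
        rintro rfl
        refine hs ?_
        have e2 : h ^ (2 * (g s * β)) ≤ h ^ (g s * β / 2) * θ := by
          rw [hθ, ← Real.rpow_add hh]
          refine Real.rpow_le_rpow_of_exponent_ge hh hh1 ?_
          have h1 := hgg s
          nlinarith [mul_le_mul_of_nonneg_right h1 hβ.le, mul_pos hg0 hβ]
        have h3 : a1 ≤ k s * (h ^ (g s * β / 2) * θ) := hs₀.trans (by gcongr)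
        have h4 : θ ≤ (k s * h ^ (g s * β / 2)) * θ := by linarith
        exact (le_mul_iff_one_le_left hθ0).1 h4
      rw [if_neg hss, e]
      have h5 : h ^ (g s * β / 2) * (k s * h ^ (g s * β / 2)) ≤ θ * 1 :=
        mul_le_mul (hle s) (not_le.1 hs).le (by positivity) hθ0.le
      linarith
  calc a1 * c0 / 2 * (t / 2) ^ g0
      ≤ a1 * c0 * (t / 2) ^ g0 - Fintype.card T * (θ / 2) := by
        have : 1 ≤ (t / 2) ^ g0 := Real.one_le_rpow ht2 hg0.le
        nlinarith [mul_pos ha1 hc0]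
    _ = ∑ s, ((if s = s₀ then a1 * c0 * (t / 2) ^ g0 else 0) - θ / 2) := by
        rw [Finset.sum_sub_distrib]
        simp
    _ ≤ _ := Finset.sum_le_sum fun s _ => hterm s

lemma half_le_floor {y : ℝ} (hy : 1 ≤ y) : y / 2 ≤ (⌊y⌋₊ : ℝ) := by
  have h1 : (1 : ℝ) ≤ ⌊y⌋₊ := by exact_mod_cast (Nat.one_le_floor_iff y).2 hy
  have h2 := Nat.lt_floor_add_one y
  linarith

/-- The probability that the vote at `x` is wrong is small when the signal at `x` exceeds the
bandwidth bias, uniformly over the sample sizes for a small bandwidth `h`. -/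
lemma exists_measure_score_le {β Cβ μlo cμ rμ a1 : ℝ} (hd : 0 < d) (hβ : 0 < β) (hCβ : 0 < Cβ)
    (hμlo : 0 < μlo) (hcμ : 0 < cμ) (hrμ : 0 < rμ) (ha1 : 0 < a1) (g c : T → ℝ)
    (hg : ∀ s, 0 < g s) (hc : ∀ s, 0 < c s) :
    ∃ h0 t0 c1 g0 : ℝ, 0 < h0 ∧ h0 ≤ 1 ∧ 1 ≤ t0 ∧ 0 < c1 ∧ 0 < g0 ∧
      ∀ (n : T → ℕ) (h : ℝ), 0 < h → h ≤ h0 →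
        (∀ s, n s * h ^ d * h ^ (2 * (g s * β)) ≤ 1) →
        (∃ s, a1 ≤ n s * h ^ d * h ^ (2 * (g s * β))) →
        ∀ (P : T → Measure (Obs d)) [∀ s, IsProbabilityMeasure (P s)] (S : Set (Cov d)) (μhi : ℝ)
          (ηQ : Cov d → ℝ) (ηP : T → Cov d → ℝ), (∀ s, DensityOn μlo μhi S (P s).fst) →
          RegularSet cμ rμ S → (∀ s, ηP s =ᵐ[(P s).fst] regression (P s)) →
          SmoothOn β Cβ S ηQ → (∀ s, RelativeSignal (g s) (c s) S ηQ (ηP s)) →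
          ∀ x ∈ S, ∀ σ t : ℝ, σ ^ 2 = 1 → t0 ≤ t → σ * (ηQ x - 1 / 2) = t * h ^ β →
            (Measure.pi fun j : Σ s, Fin (n s) => P j.1).real
              {D | σ * score (fun s => h ^ (g s * β)) (fun s => ⌊n s * h ^ d⌋₊) D x ≤ 0} ≤
            Real.exp (-(c1 * t ^ (2 * g0))) +
              Fintype.card T * Real.exp (-(h ^ (-(g0 * β / 2)))) := by
  classical
  obtain ⟨g0, hg0, hgg⟩ := exists_pos_forall_le hg
  obtain ⟨c0, hc0, hcc⟩ := exists_pos_forall_le hc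
  obtain ⟨b, hb, hball⟩ := exists_mul_pow_le_measure_closedBall (d := d) hμlo hcμ
  -- The ball of radius `M * h` has mass at least `4 h ^ d`, as Chernoff's inequality needs for `⌊n
  -- h ^ d⌋` neighbours.
  set M : ℝ := max 1 (4 / b) with hM
  have hM1 : 1 ≤ M := le_max_left _ _
  have hM0 : 0 < M := by linarith
  have hMb : 4 ≤ b * M ^ d := by
    have h1 : 4 / b ≤ M ^ d := (le_max_right _ _).trans (le_self_pow₀ hM1 hd.ne')
    rw [div_le_iff₀ hb] at h1
    linarith
  -- The condition `h ^ p ≤ ε` yields both smallness hypotheses of `le_sum_signal`, with `a1 / 2` in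
  -- place of `a1` because the floor may lose a factor `2`.
  set ε : ℝ := min (a1 / 2) (a1 / 2 * c0 / 2 / (Fintype.card T + 1)) with hε
  have hε0 : 0 < ε := by positivity
  set p : ℝ := g0 * β / 2 with hp
  have hp0 : 0 < p := by positivity
  set τ : ℝ := a1 / 2 * c0 / 2 with hτ
  have hτ0 : 0 < τ := by positivity
  set h0 : ℝ := min 1 (min (rμ / M) (ε ^ p⁻¹)) with hh0
  -- The threshold on `t` makes `t / 2 ≥ 1` and keeps the bias `Cβ (M h) ^ β` below half the signal.
  -- The constant in the exponent comes from Hoeffding's inequality with mean `τ (t / 2) ^ g0` and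
  -- variance bound `Fintype.card T`.
  refine ⟨h0, max 2 (2 * (Cβ * M ^ β)), 2 * τ ^ 2 / (Fintype.card T + 1) * ((1 / 2) ^ (2 * g0)), g0,
    by positivity, min_le_left _ _, (by norm_num : (1 : ℝ) ≤ 2).trans (le_max_left _ _),
    by positivity, hg0, ?_⟩
  intro n h hh hhh0 hn1 ⟨s₀, hs₀⟩ P _ S μhi ηQ ηP hdens hreg hver hsmooth hsig x hx σ t hσ ht hxt
  have hh1 : h ≤ 1 := hhh0.trans (min_le_left _ _)
  have hhr : M * h ≤ rμ := by
    have : h ≤ rμ / M := hhh0.trans ((min_le_right _ _).trans (min_le_left _ _))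
    rwa [le_div_iff₀' hM0] at this
  have hhε : h ^ p ≤ ε := by
    have h1 : h ≤ ε ^ p⁻¹ := hhh0.trans ((min_le_right _ _).trans (min_le_right _ _))
    calc h ^ p ≤ (ε ^ p⁻¹) ^ p := by gcongr
      _ = ε := by rw [← Real.rpow_mul hε0.le, inv_mul_cancel₀ hp0.ne', Real.rpow_one]
  have ht2 : 2 ≤ t := (le_max_left _ _).trans ht
  have htM : 2 * (Cβ * M ^ β) ≤ t := (le_max_right _ _).trans ht
  have hpowd : h ^ d ≤ 1 := pow_le_one₀ hh.le hh1
  have hkle : ∀ s, ((⌊n s * h ^ d⌋₊ : ℕ) : ℝ) ≤ n s * h ^ d := fun s =>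
    Nat.floor_le (by positivity)
  have hkn : ∀ s, ⌊n s * h ^ d⌋₊ ≤ n s := fun s => by
    have : ((⌊n s * h ^ d⌋₊ : ℕ) : ℝ) ≤ n s :=
      (hkle s).trans (mul_le_of_le_one_right (by positivity) hpowd)
    exact_mod_cast this
  have hsq : ∀ s, (h ^ (g s * β)) ^ 2 = h ^ (2 * (g s * β)) := fun s => by
    rw [← Real.rpow_natCast, ← Real.rpow_mul hh.le]
    congr 1
    push_cast
    ring
  have hcard : 0 < (Fintype.card T : ℝ) := by
    exact_mod_cast Fintype.card_pos_iff.2 ⟨s₀⟩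
  have hpε : h ^ p ≤ a1 / 2 := hhε.trans (min_le_left _ _)
  have hks₀ : a1 / 2 ≤ ((⌊n s₀ * h ^ d⌋₊ : ℕ) : ℝ) * h ^ (2 * (g s₀ * β)) := by
    have hpos : 0 < h ^ (2 * (g s₀ * β)) := by positivity
    have hle : h ^ (2 * (g s₀ * β)) ≤ h ^ p := by
      refine Real.rpow_le_rpow_of_exponent_ge hh hh1 ?_
      have h1 := hgg s₀
      rw [hp]
      nlinarith [mul_le_mul_of_nonneg_right h1 hβ.le, mul_pos hg0 hβ]
    -- Only when `n h ^ d ≥ 1` does the floor keep at least half of it.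
    have h1 : 1 ≤ n s₀ * h ^ d := by
      have : h ^ (2 * (g s₀ * β)) ≤ n s₀ * h ^ d * h ^ (2 * (g s₀ * β)) := by linarith
      exact (le_mul_iff_one_le_left hpos).1 this
    have := mul_le_mul_of_nonneg_right (half_le_floor h1) hpos.le
    linarith
  have hcardε : Fintype.card T * h ^ p ≤ a1 / 2 * c0 / 2 := by
    have h1 : h ^ p ≤ τ / (Fintype.card T + 1) := hhε.trans (min_le_right _ _)
    rw [le_div_iff₀ (by positivity)] at h1
    have : 0 < h ^ p := by positivity
    linarith
  have hsignal := le_sum_signal (fun s => ⌊n s * h ^ d⌋₊) hβ hg0 hc0 (half_pos ha1) hgg hcc hh hh1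
    ht2 hpε hcardε s₀ hks₀
  have hmain := measure_score_le (n := n) (w := fun s => h ^ (g s * β))
    (k := fun s => ⌊n s * h ^ d⌋₊) P hkn (fun s => by positivity) x (M * h) hσ
    (fun s => c s * (t * h ^ β / 2) ^ (g s))
    (Finset.univ.filter fun s => 1 ≤ ((⌊n s * h ^ d⌋₊ : ℕ) : ℝ) * h ^ (g s * β / 2))
    (V := Fintype.card T) (t := τ * (t / 2) ^ g0) ?_ ?_ ?_ (by positivity) hsignal
  · refine hmain.trans (add_le_add (Real.exp_le_exp.2 ?_) ?_)
    · have e : (t / 2) ^ g0 * (t / 2) ^ g0 = t ^ (2 * g0) * (1 / 2) ^ (2 * g0) := by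
        rw [div_eq_mul_one_div, Real.mul_rpow (by positivity) (by positivity), two_mul,
          Real.rpow_add (by positivity), Real.rpow_add (by positivity)]
        ring
      have e2 : -2 * (τ * (t / 2) ^ g0) ^ 2 / (Fintype.card T : ℝ) =
          -(2 * τ ^ 2 * (t ^ (2 * g0) * (1 / 2) ^ (2 * g0)) / (Fintype.card T : ℝ)) := by
        rw [← e]
        ring
      rw [e2, neg_le_neg_iff]
      calc _ = 2 * τ ^ 2 * (t ^ (2 * g0) * (1 / 2) ^ (2 * g0)) / (Fintype.card T + 1 : ℝ) := by ring
        _ ≤ _ := by gcongr; linarith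
    · refine (Finset.sum_le_card_nsmul _ _ (Real.exp (-(h ^ (-p)))) fun s hs => ?_).trans ?_
      -- Passing the filter means `k s ≥ h ^ (-(g s * β / 2)) ≥ h ^ (-p)`.
      · rw [Real.exp_le_exp, neg_le_neg_iff]
        have hs' : 1 ≤ ((⌊n s * h ^ d⌋₊ : ℕ) : ℝ) * h ^ (g s * β / 2) := by simpa using hs
        have hle : h ^ (g s * β / 2) ≤ h ^ p :=
          Real.rpow_le_rpow_of_exponent_ge hh hh1 (by have := hgg s; rw [hp]; gcongr)
        have hpos : 0 < h ^ p := by positivity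
        rw [Real.rpow_neg hh.le, inv_le_iff_one_le_mul₀ hpos]
        exact hs'.trans (by gcongr)
      · rw [nsmul_eq_mul]
        have : ((Finset.univ.filter fun s =>
            1 ≤ ((⌊n s * h ^ d⌋₊ : ℕ) : ℝ) * h ^ (g s * β / 2)).card : ℝ) ≤ Fintype.card T := by
          exact_mod_cast Finset.card_le_univ _
        gcongr
  · intro s
    have hS : ∀ᵐ y ∂(P s).fst, y ∈ S := by
      have := Measure.support_mem_ae (μ := (P s).fst)
      rw [(hdens s).support_eq] at this
      exact this
    filter_upwards [hS, hver s] with y hy hyv hyB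
    rw [← hyv]
    refine signal_lower_bound (hg s) (hc s) hβ hCβ hsmooth (hsig s) hx hy hσ
      (Metric.mem_closedBall.1 hyB) ?_ (by positivity) hxt
    rw [Real.mul_rpow hM0.le hh.le]
    calc 2 * (Cβ * (M ^ β * h ^ β)) = 2 * (Cβ * M ^ β) * h ^ β := by ring
      _ ≤ _ := by gcongr
  · intro s _
    have h1 := hball μhi rμ S (P s).fst (hdens s) hreg x hx (M * h) (by positivity) hhr
    calc 4 * ((⌊n s * h ^ d⌋₊ : ℕ) : ℝ) ≤ 4 * (n s * h ^ d) := by gcongr; exact hkle s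
      _ = n s * (4 * h ^ d) := by ring
      _ ≤ n s * (b * M ^ d * h ^ d) := by gcongr
      _ = n s * (b * (M * h) ^ d) := by rw [mul_pow]; ring
      _ ≤ _ := by gcongr
  · calc ∑ s, (h ^ (g s * β)) ^ 2 * ((⌊n s * h ^ d⌋₊ : ℕ) : ℝ) ≤ ∑ _s : T, (1 : ℝ) := by
          refine Finset.sum_le_sum fun s _ => ?_
          rw [hsq, mul_comm]
          refine le_trans ?_ (hn1 s)
          gcongr
          exact hkle s
      _ = Fintype.card T := by simp

end Pointwise

/-! ### The rate of convergence -/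

/-- As `2 Δ ≤ 1`, the additive error `R` costs at most `R`, and the positive part of `2 Δ π - R`
satisfies the hypotheses of `integral_le_of_margin`. On `u ≤ Δ < t0 u`, where only `π ≤ 1` is known,
the extra constant `t0 ^ (2 + α)` compensates for the decay factor. -/
lemma integral_signal_mul_le {E : Type*} [MeasurableSpace E] (ν : Measure E)
    [IsProbabilityMeasure ν] {Δ π : E → ℝ} (hΔ : Measurable Δ) (hπ : Measurable π)
    (hΔ0 : ∀ x, 0 ≤ Δ x) (hΔ1 : ∀ x, 2 * Δ x ≤ 1) (hπ0 : ∀ x, 0 ≤ π x) (hπ1 : ∀ x, π x ≤ 1)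
    {α Cα K u t0 R : ℝ} (hα : 0 ≤ α) (hCα : 0 < Cα) (hK : 0 ≤ K) (hu : 0 < u) (ht0 : 1 ≤ t0)
    (hR : 0 ≤ R)
    (hmargin : ∀ t : ℝ, 0 < t → ν.real {x | Δ x ≤ t} ≤ Cα * t ^ α)
    (hbound : ∀ᵐ x ∂ν, t0 * u ≤ Δ x → π x ≤ K * (Δ x / u) ^ (-(2 + α)) + R) :
    ∫ x, 2 * Δ x * π x ∂ν ≤ 2 * (K + t0 ^ (2 + α)) * Cα * 2 ^ (3 + α) * u ^ (1 + α) + R := by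
  have ht0p : 1 ≤ t0 ^ (2 + α) := Real.one_le_rpow ht0 (by linarith)
  have hm : Measurable fun x => 2 * Δ x * π x := (hΔ.const_mul 2).mul hπ
  have hle : ∀ x, 2 * Δ x * π x ≤ 2 * Δ x := fun x =>
    mul_le_of_le_one_right (by linarith [hΔ0 x]) (hπ1 x)
  have hnn : ∀ x, 0 ≤ 2 * Δ x * π x := fun x => by have := hΔ0 x; have := hπ0 x; positivity
  have hmax : ∫ x, max (2 * Δ x * π x - R) 0 ∂ν ≤
      2 * (K + t0 ^ (2 + α)) * Cα * 2 ^ (3 + α) * u ^ (1 + α) := by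
    refine integral_le_of_margin ν hΔ ((hm.sub_const R).max measurable_const).aestronglyMeasurable
      hα hCα (by positivity) hu hmargin (fun x => le_max_right _ _)
      (Filter.Eventually.of_forall fun x => ?_) ?_
    · have h0 := hΔ0 x
      refine max_le ?_ (by positivity)
      calc 2 * Δ x * π x - R ≤ 2 * 1 * Δ x := by linarith [hle x]
        _ ≤ _ := by gcongr; linarith
    · filter_upwards [hbound] with x hx hux
      have h0 := hΔ0 x
      have hpos : 0 < Δ x / u := div_pos (hu.trans_le hux) hu
      have hpow : 0 < (Δ x / u) ^ (-(2 + α)) := Real.rpow_pos_of_pos hpos _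
      refine max_le ?_ (by positivity)
      rcases le_or_gt (t0 * u) (Δ x) with h | h
      · have h1 : 2 * Δ x * π x ≤ 2 * Δ x * (K * (Δ x / u) ^ (-(2 + α))) + R := by
          calc 2 * Δ x * π x ≤ 2 * Δ x * (K * (Δ x / u) ^ (-(2 + α)) + R) := by
                gcongr
                exact hx h
            _ = 2 * Δ x * (K * (Δ x / u) ^ (-(2 + α))) + 2 * Δ x * R := by ring
            _ ≤ _ := by
                have := mul_le_of_le_one_left hR (hΔ1 x)
                linarith
        have h2 : 0 ≤ 2 * t0 ^ (2 + α) * Δ x * (Δ x / u) ^ (-(2 + α)) := by positivity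
        linarith
      · have h1 : 1 ≤ t0 ^ (2 + α) * (Δ x / u) ^ (-(2 + α)) := by
          have hlt : (Δ x / u) ^ (2 + α) ≤ t0 ^ (2 + α) :=
            Real.rpow_le_rpow hpos.le ((div_le_iff₀ hu).2 h.le) (by linarith)
          rw [Real.rpow_neg hpos.le, ← div_eq_mul_inv, one_le_div (Real.rpow_pos_of_pos hpos _)]
          exact hlt
        have h2 : 2 * Δ x * 1 ≤ 2 * Δ x * (t0 ^ (2 + α) * (Δ x / u) ^ (-(2 + α))) := by gcongr
        have h3 : 0 ≤ 2 * K * Δ x * (Δ x / u) ^ (-(2 + α)) := by positivity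
        linarith [hle x]
  have hint : Integrable (fun x => max (2 * Δ x * π x - R) 0) ν := by
    refine Integrable.of_bound (C := 1)
      ((hm.sub_const R).max measurable_const).aestronglyMeasurable
      (Filter.Eventually.of_forall fun x => ?_)
    rw [Real.norm_of_nonneg (le_max_right _ _)]
    exact max_le (by linarith [hle x, hΔ1 x]) zero_le_one
  calc ∫ x, 2 * Δ x * π x ∂ν ≤ ∫ x, (max (2 * Δ x * π x - R) 0 + R) ∂ν := by
        refine integral_mono_of_nonneg (Filter.Eventually.of_forall hnn)
          (hint.add (integrable_const R)) (Filter.Eventually.of_forall fun x => ?_)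
        have := le_max_left (2 * Δ x * π x - R) 0
        simp only
        linarith
    _ = ∫ x, max (2 * Δ x * π x - R) 0 ∂ν + R := by
        rw [integral_add hint (integrable_const R)]
        simp
    _ ≤ _ := by gcongr

/-! ### Effective sample size and bandwidth -/

section Sizes

variable {d m : ℕ}

/-- The signal exponents, with the target exponent `1` listed first. -/
def exponents (γ : Fin m → ℝ) (s : Option (Fin m)) : ℝ := s.elim 1 γ

/-- The bandwidth that corresponds to the effective sample size `N`. -/
noncomputable def bandwidth (d : ℕ) (β N : ℝ) : ℝ := N ^ (-1 / (2 * β + d))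

lemma bandwidth_rpow {β N : ℝ} (hN : 0 ≤ N) (a : ℝ) :
    bandwidth d β N ^ a = N ^ (-a / (2 * β + d)) := by
  rw [bandwidth, ← Real.rpow_mul hN]
  congr 1
  ring

lemma weight_eq {β N : ℝ} (hN : 0 ≤ N) (g : ℝ) :
    weight d β g N = bandwidth d β N ^ (g * β) := by
  rw [bandwidth_rpow hN, weight]

lemma numNeighbors_eq {β N : ℝ} (hN : 0 ≤ N) (n : ℕ) :
    numNeighbors d β N n = ⌊n * bandwidth d β N ^ d⌋₊ := by
  rw [← Real.rpow_natCast, bandwidth_rpow hN, numNeighbors]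

/-- A classification error at `x` means that the pooled vote goes against the right label. -/
lemma score_nonpos_of_fHat_ne {β : ℝ} {γ : Fin m → ℝ} {nQ : ℕ} {nP : Fin m → ℕ}
    (hN : 0 < effSize d β γ nQ nP) (D : Sample d nQ nP) (x : Cov d) {b : Bool}
    (h : fHat β γ D x ≠ b) :
    (if b then 1 else -1) *
      score (fun s => weight d β (exponents γ s) (effSize d β γ nQ nP))
        (fun s => numNeighbors d β (effSize d β γ nQ nP) (sizes nQ nP s)) (flatten D) x ≤ 0 := by
  set N := effSize d β γ nQ nP with hNdef
  set w := fun s => weight d β (exponents γ s) N with hw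
  set k := fun s => numNeighbors d β N (sizes nQ nP s) with hk
  set W : ℝ := ∑ s, w s * k s with hW
  set A : ℝ := ∑ s, w s * nnLabelSum (fun j => flatten D ⟨s, j⟩) (k s) x with hA
  have hwpos : ∀ s, 0 < w s := fun s => Real.rpow_pos_of_pos hN _
  have hnn : ∀ s, 0 ≤ w s * k s := fun s => mul_nonneg (hwpos s).le (Nat.cast_nonneg _)
  have heta : etaHat β γ D x = A / W := by
    rw [hA, hW, Fintype.sum_option, Fintype.sum_option]
    rfl
  have hscore : score w k (flatten D) x = A - W / 2 := by
    rw [hA, hW, score, Finset.sum_div, ← Finset.sum_sub_distrib]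
    exact Finset.sum_congr rfl fun s _ => by ring
  have hW0 : 0 ≤ W := Finset.sum_nonneg fun s _ => hnn s
  -- If no neighbour is used, the estimate is `0 / 0 = 0`, but the vote is `0` too and the claim
  -- holds for either label.
  rcases hW0.eq_or_lt with h0 | hpos
  · have hk0 : ∀ s, k s = 0 := fun s => by
      have := (Finset.sum_eq_zero_iff_of_nonneg fun s _ => hnn s).1 h0.symm s (Finset.mem_univ s)
      simpa [(hwpos s).ne'] using this
    have : score w k (flatten D) x = 0 :=
      Finset.sum_eq_zero fun s _ => by simp [hk0, nnLabelSum]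
    simp [this]
  · rw [hscore]
    cases b
    · have h1 : 1 / 2 < A / W := by simpa [fHat, heta] using h
      rw [lt_div_iff₀ hpos] at h1
      simp only [Bool.false_eq_true, if_false]
      linarith
    · have h1 : A / W ≤ 1 / 2 := by simpa [fHat, heta] using h
      rw [div_le_iff₀ hpos] at h1
      simp only [if_true]
      linarith

lemma effSize_eq_sum {β : ℝ} (hβ : 0 < β) (γ : Fin m → ℝ) (nQ : ℕ) (nP : Fin m → ℕ) :
    effSize d β γ nQ nP =
      ∑ s, (sizes nQ nP s : ℝ) ^ ((2 * β + d) / (2 * exponents γ s * β + d)) := by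
  have hb : 2 * β + d ≠ 0 := by positivity
  rw [Fintype.sum_option]
  simp [sizes, exponents, effSize, div_self hb]

lemma one_le_effSize {β : ℝ} (hβ : 0 < β) {γ : Fin m → ℝ} (hγ : ∀ i, 0 < γ i) {nQ : ℕ}
    {nP : Fin m → ℕ} (hn : 0 < nQ + ∑ i, nP i) : 1 ≤ effSize d β γ nQ nP := by
  have hnn : ∀ i, 0 ≤ (nP i : ℝ) ^ ((2 * β + d) / (2 * γ i * β + d)) := fun i => by positivity
  rcases Nat.eq_zero_or_pos nQ with h0 | hpos
  · have : ∃ i, 0 < nP i := by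
      by_contra! hall
      have : ∑ i, nP i = 0 := Finset.sum_eq_zero fun i _ => Nat.le_zero.1 (hall i)
      omega
    obtain ⟨i, hi⟩ := this
    have h1 : (1 : ℝ) ≤ nP i := by exact_mod_cast hi
    have hγi := hγ i
    have h2 := Real.one_le_rpow h1 (z := (2 * β + d) / (2 * γ i * β + d)) (by positivity)
    have h3 := Finset.single_le_sum (fun i _ => hnn i) (Finset.mem_univ i)
    have h4 : (0 : ℝ) ≤ nQ := Nat.cast_nonneg _
    unfold effSize
    linarith
  · have h1 : (1 : ℝ) ≤ nQ := by exact_mod_cast hpos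
    have h2 := Finset.sum_nonneg fun i (_ : i ∈ Finset.univ) => hnn i
    unfold effSize
    linarith

lemma mul_bandwidth_rpow {β g N : ℝ} (hN : 0 < N) (n : ℕ) :
    n * bandwidth d β N ^ d * bandwidth d β N ^ (2 * (g * β)) =
      n * N ^ (-((2 * g * β + d) / (2 * β + d))) := by
  rw [mul_assoc, ← Real.rpow_natCast, bandwidth_rpow hN.le, bandwidth_rpow hN.le,
    ← Real.rpow_add hN]
  congr 2
  ring

/-- The exponent in `effSize` is chosen for this: it is the reciprocal of the power of `N` in
`mul_bandwidth_rpow`. -/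
lemma mul_bandwidth_rpow_le_one {β : ℝ} (hβ : 0 < β) {g N : ℝ} (hg : 0 < g) (hN : 0 < N) {n : ℕ}
    (hn : (n : ℝ) ^ ((2 * β + d) / (2 * g * β + d)) ≤ N) :
    n * bandwidth d β N ^ d * bandwidth d β N ^ (2 * (g * β)) ≤ 1 := by
  rw [mul_bandwidth_rpow hN, Real.rpow_neg hN.le, ← div_eq_mul_inv,
    div_le_one (Real.rpow_pos_of_pos hN _)]
  have h := Real.rpow_le_rpow (by positivity) hn
    (z := (2 * g * β + d) / (2 * β + d)) (by positivity)
  rwa [← Real.rpow_mul (Nat.cast_nonneg n), div_mul_div_cancel₀ (by positivity),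
    div_self (by positivity), Real.rpow_one] at h

lemma le_mul_bandwidth_rpow {β : ℝ} (hβ : 0 < β) {g N a : ℝ} (hg : 0 < g) (hN : 0 < N)
    (ha : 0 < a) {n : ℕ} (hn : a * N ≤ (n : ℝ) ^ ((2 * β + d) / (2 * g * β + d))) :
    a ^ ((2 * g * β + d) / (2 * β + d)) ≤
      n * bandwidth d β N ^ d * bandwidth d β N ^ (2 * (g * β)) := by
  rw [mul_bandwidth_rpow hN, Real.rpow_neg hN.le, ← div_eq_mul_inv,
    le_div_iff₀ (Real.rpow_pos_of_pos hN _), ← Real.mul_rpow ha.le hN.le]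
  have h := Real.rpow_le_rpow (by positivity) hn
    (z := (2 * g * β + d) / (2 * β + d)) (by positivity)
  rwa [← Real.rpow_mul (Nat.cast_nonneg n), div_mul_div_cancel₀ (by positivity),
    div_self (by positivity), Real.rpow_one] at h

end Sizes

section Rate

variable {d m : ℕ}

/-- The constants of the relative signal conditions, with the trivial one for the target. -/
def signalConstants (Cγ : Fin m → ℝ) (s : Option (Fin m)) : ℝ := s.elim 1 Cγ

/-- The expected excess risk when the effective sample size is large, that is when the bandwidth
is small. -/
lemma exists_integral_excessRisk_le (hd : 0 < d)
    {α Cα β Cβ : ℝ} (hα : 0 ≤ α) (hCα : 0 < Cα) (hβ : 0 < β) (hCβ : 0 < Cβ)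
    {γ Cγ : Fin m → ℝ} (hγ : ∀ i, 0 < γ i) (hCγ : ∀ i, 0 < Cγ i)
    {μlo μhi cμ rμ : ℝ} (hμlo : 0 < μlo) (hcμ : 0 < cμ) (hrμ : 0 < rμ) :
    ∃ C h0 : ℝ, 0 < C ∧ 0 < h0 ∧
      ∀ (nQ : ℕ) (nP : Fin m → ℕ), 0 < nQ + ∑ i, nP i →
        bandwidth d β (effSize d β γ nQ nP) ≤ h0 →
        ∀ (P : Fin m → Measure (Obs d)) [∀ i, IsProbabilityMeasure (P i)]
          (Q : Measure (Obs d)) [IsProbabilityMeasure Q],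
          InClass α Cα β Cβ γ Cγ μlo μhi cμ rμ P Q →
            ∫ D, excessRisk Q (fHat β γ D) ∂(sampleLaw P Q nQ nP) ≤
              C * bandwidth d β (effSize d β γ nQ nP) ^ (β * (1 + α)) := by
  classical
  have hg : ∀ s, 0 < exponents γ s := fun s => by
    cases s
    · exact one_pos
    · exact hγ _
  have hc : ∀ s, 0 < signalConstants Cγ s := fun s => by
    cases s
    · exact one_pos
    · exact hCγ _
  have hm1 : (0 : ℝ) < ((m : ℝ) + 1)⁻¹ := by positivity
  -- By pigeonhole one of the `m + 1` samples supplies a share `1 / (m + 1)` of `N`; `a1` is the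
  -- resulting lower bound, whichever sample it is.
  obtain ⟨a1, ha1, ha1le⟩ := exists_pos_forall_le
    (f := fun s : Option (Fin m) =>
      ((m : ℝ) + 1)⁻¹ ^ ((2 * exponents γ s * β + d) / (2 * β + d)))
    fun s => Real.rpow_pos_of_pos hm1 _
  obtain ⟨h0, t0, c1, g0, hh0, hh01, ht0, hc1, hg0, hpoint⟩ :=
    exists_measure_score_le hd hβ hCβ hμlo hcμ hrμ ha1 (exponents γ) (signalConstants Cγ) hg hc
  -- These exponents turn `exp (-c1 t ^ (2 g0))` into a multiple of `t ^ (-(2 + α))`, and `exp (-h ^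
  -- (-g0 β / 2))` into a multiple of `h ^ (β (1 + α))`.
  set q1 : ℝ := (2 + α) / (2 * g0) with hq1
  have hq1pos : 0 < q1 := by positivity
  set q2 : ℝ := 2 * (1 + α) / g0 with hq2
  have hq2pos : 0 < q2 := by positivity
  set K : ℝ := q1 ^ q1 * c1 ^ (-q1) with hK
  have hKpos : 0 < K := by positivity
  refine ⟨2 * (K + t0 ^ (2 + α)) * Cα * 2 ^ (3 + α) + (m + 1) * q2 ^ q2, h0, by positivity, hh0, ?_⟩
  intro nQ nP hn hbw P _ Q _ hclass
  obtain ⟨ηQ, ηP, hηQ, hηP, hsmooth, hmargin, hsig⟩ := hclass.regression_conditions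
  set N := effSize d β γ nQ nP with hNdef
  have hN1 : 1 ≤ N := one_le_effSize hβ hγ hn
  have hN : 0 < N := by linarith
  set h := bandwidth d β N with hh
  have hhpos : 0 < h := Real.rpow_pos_of_pos hN _
  set u := h ^ β with hu
  have hupos : 0 < u := by positivity
  have hsum : N = ∑ s, (sizes nQ nP s : ℝ) ^ ((2 * β + d) / (2 * exponents γ s * β + d)) :=
    effSize_eq_sum hβ γ nQ nP
  have hsizes : ∀ s, (sizes nQ nP s : ℝ) * h ^ d * h ^ (2 * (exponents γ s * β)) ≤ 1 := fun s => by
    refine mul_bandwidth_rpow_le_one hβ (hg s) hN ?_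
    rw [hsum]
    exact Finset.single_le_sum
      (f := fun s => (sizes nQ nP s : ℝ) ^ ((2 * β + d) / (2 * exponents γ s * β + d)))
      (fun s _ => Real.rpow_nonneg (Nat.cast_nonneg _) _) (Finset.mem_univ s)
  have hlarge : ∃ s, a1 ≤ (sizes nQ nP s : ℝ) * h ^ d * h ^ (2 * (exponents γ s * β)) := by
    have : ∃ s, ((m : ℝ) + 1)⁻¹ * N ≤
        (sizes nQ nP s : ℝ) ^ ((2 * β + d) / (2 * exponents γ s * β + d)) := by
      by_contra! hall
      have hlt := Finset.sum_lt_sum_of_nonempty (s := Finset.univ) ⟨none, Finset.mem_univ _⟩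
        fun s _ => hall s
      rw [← hsum, Finset.sum_const, Finset.card_univ, Fintype.card_option, Fintype.card_fin,
        nsmul_eq_mul] at hlt
      push_cast at hlt
      rw [← mul_assoc, mul_inv_cancel₀ (by positivity), one_mul] at hlt
      exact lt_irrefl _ hlt
    obtain ⟨s, hs⟩ := this
    exact ⟨s, (ha1le s).trans (le_mul_bandwidth_rpow hβ (hg s) hN hm1 hs)⟩
  set n := sizes nQ nP with hnd
  set ηs : Option (Fin m) → Cov d → ℝ := fun s => s.elim ηQ ηP with hηs
  have hvers : ∀ s, ηs s =ᵐ[(laws P Q s).fst] regression (laws P Q s) := fun s => by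
    cases s
    · exact hηQ
    · exact hηP _
  have hdens : ∀ s, DensityOn μlo μhi Q.fst.support (laws P Q s).fst := fun s => by
    cases s
    · exact hclass.density_target
    · exact hclass.density_source _
  have hsigs : ∀ s, RelativeSignal (exponents γ s) (signalConstants Cγ s) Q.fst.support ηQ
      (ηs s) := fun s => by
    cases s
    -- The target is a source for itself, with exponent and constant `1`.
    · intro y _
      refine ⟨mul_self_nonneg _, ?_⟩
      simp [signalConstants, exponents, hηs]
    · exact hsig _
  have hsS : ∀ᵐ x ∂Q.fst, x ∈ Q.fst.support := Measure.support_mem_ae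
  set R : ℝ := (m + 1) * q2 ^ q2 * h ^ (β * (1 + α)) with hR
  have hF := measurable_fHat (d := d) β γ (nQ := nQ) (nP := nP)
  have hprob : IsProbabilityMeasure (sampleLaw P Q nQ nP) := by
    unfold sampleLaw
    infer_instance
  rw [integral_excessRisk Q (sampleLaw P Q nQ nP) hF]
  have hreg0 := regression_nonneg Q
  have hreg1 := regression_le_one Q
  have habs : ∀ x, 2 * |regression Q x - 1 / 2| ≤ 1 := fun x => by
    have : |regression Q x - 1 / 2| ≤ 1 / 2 := by
      have := hreg0 x
      have := hreg1 x
      rw [abs_le]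
      constructor <;> linarith
    linarith
  have hπ : Measurable fun x => (sampleLaw P Q nQ nP).real {D | fHat β γ D x ≠ bayes Q x} := by
    refine Measurable.ennreal_toReal ?_
    exact measurable_measure_prodMk_right
      (measurableSet_eq_fun hF ((measurable_bayes Q).comp measurable_snd)).compl
  have hmain := integral_signal_mul_le Q.fst
    (Δ := fun x => |regression Q x - 1 / 2|)
    (π := fun x => (sampleLaw P Q nQ nP).real {D | fHat β γ D x ≠ bayes Q x})
    (α := α) (Cα := Cα) (K := K) (u := u) (t0 := t0) (R := R)
    ((measurable_regression Q).sub_const _).abs hπ (fun x => abs_nonneg _) habs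
    (fun x => measureReal_nonneg) (fun x => measureReal_le_one) hα hCα hKpos.le hupos ht0
    (by positivity) ?_ ?_
  · refine hmain.trans_eq ?_
    rw [hR, hu, ← Real.rpow_mul hhpos.le]
    ring
  · intro t ht
    refine le_of_eq_of_le ?_ (hmargin t ht)
    refine measureReal_congr ?_
    filter_upwards [hηQ] with x hx
    apply propext
    change |regression Q x - 1 / 2| ≤ t ↔ |ηQ x - 1 / 2| ≤ t
    rw [hx]
  · filter_upwards [hsS, hηQ] with x hxS hxη hxt
    set t := |regression Q x - 1 / 2| / u with htdef
    have htt0 : t0 ≤ t := (le_div_iff₀ hupos).2 hxt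
    have htpos : 0 < t := by linarith
    have htu : t * h ^ β = |regression Q x - 1 / 2| := div_mul_cancel₀ _ hupos.ne'
    -- The sign of the Bayes label makes the signal at `x` equal to its absolute value.
    set σ : ℝ := if bayes Q x then 1 else -1 with hσdef
    have hσ : σ ^ 2 = 1 := by
      rw [hσdef]
      split_ifs <;> norm_num
    have hσx : σ * (ηQ x - 1 / 2) = t * h ^ β := by
      rw [htu, hxη, hσdef]
      by_cases hb : 1 / 2 < regression Q x
      · rw [if_pos (by simpa [bayes] using hb), abs_of_pos (by linarith), one_mul]
      · rw [if_neg (by simpa [bayes] using hb), abs_of_nonpos (by linarith)]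
        ring
    have hpx := hpoint n h hhpos hbw hsizes hlarge (laws P Q) Q.fst.support μhi ηQ ηs hdens
      hclass.regular hvers hsmooth hsigs x hxS σ t hσ htt0 hσx
    have hsub : (sampleLaw P Q nQ nP).real {D | fHat β γ D x ≠ bayes Q x} ≤
        (Measure.pi fun j : Σ s, Fin (n s) => laws P Q j.1).real
          {D | σ * score (fun s => h ^ (exponents γ s * β)) (fun s => ⌊n s * h ^ d⌋₊) D x ≤ 0} := by
      rw [← map_flatten_sampleLaw, map_measureReal_apply measurable_flatten
        (measurableSet_le ((measurable_score x).const_mul σ) measurable_const)]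
      refine measureReal_mono fun D hD => ?_
      have := score_nonpos_of_fHat_ne hN D x hD
      simp only [weight_eq hN.le, numNeighbors_eq hN.le, ← hNdef] at this
      exact this
    refine (hsub.trans hpx).trans (add_le_add ?_ ?_)
    · refine (exp_neg_le_rpow hq1pos (by positivity)).trans_eq ?_
      rw [Real.mul_rpow hc1.le (by positivity), ← Real.rpow_mul htpos.le, hK, hq1]
      have : 2 * g0 * -((2 + α) / (2 * g0)) = -(2 + α) := by field_simp
      rw [this]
      ring
    · have h1 := exp_neg_le_rpow hq2pos (y := h ^ (-(g0 * β / 2))) (by positivity)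
      have h2 : (h ^ (-(g0 * β / 2))) ^ (-q2) = h ^ (β * (1 + α)) := by
        rw [← Real.rpow_mul hhpos.le, hq2]
        congr 1
        field_simp
      rw [h2] at h1
      rw [Fintype.card_option, Fintype.card_fin, hR, mul_assoc]
      push_cast
      gcongr

end Rate

end TransferKNN

theorem mainTheorem7 (d m : ℕ) (hd : 0 < d) (hm : 0 < m)
    (α Cα β Cβ : ℝ) (hα : 0 ≤ α) (hCα : 0 < Cα) (hβ : 0 < β) (hCβ : 0 < Cβ)
    (γ Cγ : Fin m → ℝ) (hγ : ∀ i, 0 < γ i) (hCγ : ∀ i, 0 < Cγ i)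
    (μlo μhi cμ rμ : ℝ) (hμlo : 0 < μlo) (hμ : μlo < μhi) (hcμ : 0 < cμ) (hrμ : 0 < rμ) :
    ∃ C : ℝ, 0 < C ∧
      ∀ (nQ : ℕ) (nP : Fin m → ℕ), 0 < nQ + ∑ i, nP i →
        ∀ (P : Fin m → MeasureTheory.Measure (TransferKNN.Obs d))
          [∀ i, MeasureTheory.IsProbabilityMeasure (P i)]
          (Q : MeasureTheory.Measure (TransferKNN.Obs d)) [MeasureTheory.IsProbabilityMeasure Q],
          TransferKNN.InClass α Cα β Cβ γ Cγ μlo μhi cμ rμ P Q →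
            MeasureTheory.Integrable
              (fun D => TransferKNN.excessRisk Q (TransferKNN.fHat β γ D))
              (TransferKNN.sampleLaw P Q nQ nP) ∧
            ∫ D, TransferKNN.excessRisk Q (TransferKNN.fHat β γ D)
                ∂(TransferKNN.sampleLaw P Q nQ nP) ≤
              C * m * (TransferKNN.effSize d β γ nQ nP) ^ (-(β * (1 + α)) / (2 * β + d)) := by
  obtain ⟨C, h0, hC, hh0, hmain⟩ := TransferKNN.exists_integral_excessRisk_le (d := d) (μhi := μhi)
    hd hα hCα hβ hCβ hγ hCγ hμlo hcμ hrμ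
  set p : ℝ := β * (1 + α) with hp
  have hppos : 0 < p := by positivity
  have hm1 : (1 : ℝ) ≤ m := by exact_mod_cast hm
  -- The second summand covers bandwidths `h > h0`, where the excess risk is at most `1 ≤ (h / h0) ^
  -- p`.
  refine ⟨C + (h0 ^ p)⁻¹, by positivity, ?_⟩
  intro nQ nP hn P _ Q _ hclass
  have hprob : IsProbabilityMeasure (TransferKNN.sampleLaw P Q nQ nP) := by
    unfold TransferKNN.sampleLaw
    infer_instance
  have hint := TransferKNN.integrable_excessRisk Q (TransferKNN.sampleLaw P Q nQ nP)
    (TransferKNN.measurable_fHat β γ)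
  refine ⟨hint, ?_⟩
  have hN : 0 < TransferKNN.effSize d β γ nQ nP := by
    linarith [TransferKNN.one_le_effSize (d := d) hβ hγ hn]
  rw [← TransferKNN.bandwidth_rpow hN.le]
  set h := TransferKNN.bandwidth d β (TransferKNN.effSize d β γ nQ nP) with hh
  have hhpos : 0 < h := Real.rpow_pos_of_pos hN _
  have hhp : 0 < h ^ p := by positivity
  have hh0p : 0 < h0 ^ p := by positivity
  suffices hsuff : ∫ D, TransferKNN.excessRisk Q (TransferKNN.fHat β γ D)
      ∂(TransferKNN.sampleLaw P Q nQ nP) ≤ (C + (h0 ^ p)⁻¹) * h ^ p by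
    refine hsuff.trans ?_
    gcongr
    exact le_mul_of_one_le_right (by positivity) hm1
  rcases le_or_gt h h0 with hle | hlt
  · refine (hmain nQ nP hn hle P Q hclass).trans ?_
    gcongr
    exact le_add_of_nonneg_right (by positivity)
  · calc ∫ D, TransferKNN.excessRisk Q (TransferKNN.fHat β γ D)
          ∂(TransferKNN.sampleLaw P Q nQ nP)
        ≤ ∫ _, (1 : ℝ) ∂(TransferKNN.sampleLaw P Q nQ nP) :=
          integral_mono hint (integrable_const 1) fun D => TransferKNN.excessRisk_le_one Q _
      _ = (h0 ^ p)⁻¹ * h0 ^ p := by simp [inv_mul_cancel₀ hh0p.ne']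
      _ ≤ (C + (h0 ^ p)⁻¹) * h ^ p := by
          gcongr
          exact le_add_of_nonneg_left hC.le
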